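/- All topological groups are assumed to be second countable and Hausdorff. A Cayley-Abels graph of a totally disconnected locally compact (TDLC) group $G$ is a connected locally finite graph (with edges of length one) on which $G$ acts by automorphisms, vertex transitively, with compact open vertex stabilizers. A compactly generated TDLC group is hyperbolic if some (equivalently, any) Cayley-Abels graph of it is Gromov hyperbolic. A subgroup $H$ of a hyperbolic TDLC group $G$ with Cayley-Abels graph $X$ is quasiconvex if, for some vertex $x$ of $X$, there is a constant $D\ge 0$ such that every geodesic of $X$ joining two points of the orbit $Hx$ lies in the $D$-neighbourhood of $Hx$; this does not depend on the choice of $X$. Let $G$ be a hyperbolic TDLC group and let $H\le G$ be an open subgroup which is itself a hyperbolic TDLC group. Let $U\le G$ be a compact open subgroup and $U_H=U\cap H$. Let $A_G\subset G$ and $A_H\subset H$ be finite symmetric sets containing the identity, with $A_H\subset A_G$, $UA_GU=A_GU$, $G=\langle A_G\rangle U$, $U_HA_HU_H=A_HU_H$ and $H=\langle A_H\rangle U_H$. Let $\Gamma_G$ be the Cayley-Abels graph of $G$ with vertices $gU$ and edges $\{gU,gaU\}$ ($g\in G$, $a\in A_G$), let $\Gamma_H$ be the Cayley-Abels graph of $H$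 defined in the same way from $U_H$ and $A_H$, and let $\iota:\Gamma_H\to\Gamma_G$ be the embedding $hU_H\mapsto hU$. Write $\partial H=\partial\Gamma_H$ and $\partial G=\partial\Gamma_G$ for the Gromov boundaries. Suppose that the pair $(H,G)$ admits a Cannon-Thurston map, that is, a map $\partial\iota:\partial H\to\partial G$ such that $\iota\cup\partial\iota:\Gamma_H\cup\partial H\to\Gamma_G\cup\partial G$ is continuous for the usual topologies on the unions of the graphs with their Gromov boundaries. Then $\partial\iota$ is injective if and only if $H$ is quasiconvex in $G$. -/

import Mathlib

universe u v

/-! ## Coarse geometry of graphs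

A connected graph is regarded as a metric space by giving each edge length one.  All the notions
below are expressed on the vertex set with the path metric: geodesics issuing from a vertex and
(when finite) ending at a vertex are exactly the geodesic edge paths, and the vertex set is
isometrically embedded and coarsely dense in the geometric realisation. -/

namespace GraphGeometry

variable {V : Type u}

/-- The Gromov product `(y | z)_w = (d(w, y) + d(w, z) - d(y, z)) / 2` for the path metric. -/
noncomputable def gromovProduct (X : SimpleGraph V) (w y z : V) : ℝ :=
  ((X.dist w y : ℝ) + (X.dist w z : ℝ) - (X.dist y z : ℝ)) / 2

/-- Gromov hyperbolicity of the path metric: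
`(x | z)_w ≥ min ((x | y)_w) ((y | z)_w) - δ` for some constant `δ`. -/
def IsGromovHyperbolic (X : SimpleGraph V) : Prop :=
  ∃ δ : ℝ, ∀ w x y z : V,
    min (gromovProduct X w x y) (gromovProduct X w y z) - δ ≤ gromovProduct X w x z

/-- A set `S` of vertices is quasiconvex if there is a constant `D` such that every geodesic
joining two elements of `S` lies in the `D`-neighbourhood of `S`. -/
def IsQuasiconvex (X : SimpleGraph V) (S : Set V) : Prop :=
  ∃ D : ℕ, ∀ x ∈ S, ∀ y ∈ S, ∀ p : X.Walk x y, p.length = X.dist x y →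
    ∀ z ∈ p.support, ∃ s ∈ S, X.dist z s ≤ D

/-- Geodesic rays starting at the vertex `x₀`, recorded through the vertices that they visit at
integer times. -/
structure GeodesicRay (X : SimpleGraph V) (x₀ : V) where
  toFun : ℕ → V
  start : toFun 0 = x₀
  geodesic : ∀ m k : ℕ, X.edist (toFun m) (toFun (m + k)) = k

/-- Two geodesic rays are asymptotic if their Hausdorff distance is finite. -/
def Asymptotic {X : SimpleGraph V} {x₀ : V} (γ γ' : GeodesicRay X x₀) : Prop :=
  ∃ D : ℕ, (∀ m, ∃ n, X.edist (γ.toFun m) (γ'.toFun n) ≤ D) ∧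
    (∀ n, ∃ m, X.edist (γ.toFun m) (γ'.toFun n) ≤ D)

instance raySetoid (X : SimpleGraph V) (x₀ : V) : Setoid (GeodesicRay X x₀) where
  r := Asymptotic
  iseqv := by
    refine ⟨fun γ => ⟨0, fun m => ⟨m, by simp⟩, fun m => ⟨m, by simp⟩⟩, ?_, ?_⟩
    · rintro γ γ' ⟨D, h₁, h₂⟩
      refine ⟨D, fun m => ?_, fun n => ?_⟩
      · obtain ⟨n, hn⟩ := h₂ m
        exact ⟨n, by rwa [SimpleGraph.edist_comm]⟩
      · obtain ⟨m, hm⟩ := h₁ n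
        exact ⟨m, by rwa [SimpleGraph.edist_comm]⟩
    · rintro γ γ' γ'' ⟨D, h₁, h₂⟩ ⟨E, h₃, h₄⟩
      refine ⟨D + E, fun m => ?_, fun n => ?_⟩
      · obtain ⟨n, hn⟩ := h₁ m
        obtain ⟨k, hk⟩ := h₃ n
        refine ⟨k, (SimpleGraph.edist_triangle (v := γ'.toFun n)).trans ?_⟩
        push_cast
        exact add_le_add hn hk
      · obtain ⟨k, hk⟩ := h₄ n
        obtain ⟨m, hm⟩ := h₂ k
        refine ⟨m, (SimpleGraph.edist_triangle (v := γ'.toFun k)).trans ?_⟩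
        push_cast
        exact add_le_add hm hk

/-- The Gromov boundary: geodesic rays from `x₀` up to finite Hausdorff distance. -/
def GromovBoundary (X : SimpleGraph V) (x₀ : V) : Type u :=
  Quotient (raySetoid X x₀)

/-- The vertex set together with the Gromov boundary. -/
inductive Compactification (X : SimpleGraph V) (x₀ : V) : Type u
  | vertex (x : V) : Compactification X x₀
  | ideal (ξ : GromovBoundary X x₀) : Compactification X x₀

namespace Compactification

variable {X : SimpleGraph V} {x₀ : V}

/-- The sequences that represent a point: the constant sequence for a vertex, and the geodesic
rays in the class `ξ` for a boundary point `ξ`. -/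
def Represents : Compactification X x₀ → (ℕ → V) → Prop
  | vertex x, s => ∀ n, s n = x
  | ideal ξ, s => ∃ γ : GeodesicRay X x₀, Quotient.mk (raySetoid X x₀) γ = ξ ∧ s = γ.toFun

/-- The basic neighbourhood `{y | (y | ξ)_{x₀} ≥ R}` of a boundary point `ξ`, the Gromov product
being extended to boundary points through limits along representing rays. -/
def nbhd (ξ : GromovBoundary X x₀) (R : ℝ) : Set (Compactification X x₀) :=
  {y | ∃ s t : ℕ → V, Represents y s ∧ Represents (ideal ξ) t ∧
    ∃ N : ℕ, ∀ m ≥ N, ∀ n ≥ N, R ≤ gromovProduct X x₀ (s m) (t n)}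

/-- The usual topology on the union of a hyperbolic graph and its Gromov boundary (restricted to
vertices and boundary points): vertices are isolated, and the sets `nbhd ξ R` are the basic
neighbourhoods of the boundary point `ξ`. -/
instance : TopologicalSpace (Compactification X x₀) where
  IsOpen O := ∀ ξ : GromovBoundary X x₀, ideal ξ ∈ O → ∃ R : ℝ, nbhd ξ R ⊆ O
  isOpen_univ := fun _ _ => ⟨0, Set.subset_univ _⟩
  isOpen_inter := by
    rintro O O' h h' ξ ⟨hξ, hξ'⟩
    obtain ⟨R, hR⟩ := h ξ hξ
    obtain ⟨R', hR'⟩ := h' ξ hξ'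
    refine ⟨max R R', fun y hy => ⟨hR ?_, hR' ?_⟩⟩
    · obtain ⟨s, t, hs, ht, N, hN⟩ := hy
      exact ⟨s, t, hs, ht, N, fun m hm n hn => (le_max_left _ _).trans (hN m hm n hn)⟩
    · obtain ⟨s, t, hs, ht, N, hN⟩ := hy
      exact ⟨s, t, hs, ht, N, fun m hm n hn => (le_max_right _ _).trans (hN m hm n hn)⟩
  isOpen_sUnion := by
    rintro 𝒪 h ξ ⟨O, hO, hξ⟩
    obtain ⟨R, hR⟩ := h O hO ξ hξ
    exact ⟨R, hR.trans (Set.subset_sUnion_of_mem hO)⟩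

end Compactification

/-- The map between compactifications given by `f` on vertices and by `g` on the boundary. -/
def extendMap {V : Type u} {W : Type v} {Y : SimpleGraph V} {y₀ : V} {X : SimpleGraph W} {x₀ : W}
    (f : V → W) (g : GromovBoundary Y y₀ → GromovBoundary X x₀) :
    Compactification Y y₀ → Compactification X x₀
  | .vertex y => .vertex (f y)
  | .ideal ξ => .ideal (g ξ)

/-- `g` is a Cannon-Thurston map for `f`: together, `f` and `g` form a continuous map. -/
def IsCannonThurstonMap {V : Type u} {W : Type v} {Y : SimpleGraph V} {y₀ : V}
    {X : SimpleGraph W} {x₀ : W} (f : V → W)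
    (g : GromovBoundary Y y₀ → GromovBoundary X x₀) : Prop :=
  Continuous (extendMap f g)

end GraphGeometry

/-! ## Cayley-Abels graphs and hyperbolic groups -/

namespace TDLC

open GraphGeometry
open scoped Pointwise

/-- A Cayley-Abels graph of `G`: a locally finite connected graph on which `G` acts by graph
automorphisms, vertex transitively and with compact open vertex stabilizers. -/
structure IsCayleyAbelsGraph (G : Type u) [Group G] [TopologicalSpace G] {V : Type v}
    [MulAction G V] (X : SimpleGraph V) : Prop where
  connected : X.Connected
  locallyFinite : ∀ x : V, (X.neighborSet x).Finite
  adj_smul_iff : ∀ (g : G) (x y : V), X.Adj (g • x) (g • y) ↔ X.Adj x y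
  transitive : MulAction.IsPretransitive G V
  isCompact_stabilizer : ∀ x : V, IsCompact (MulAction.stabilizer G x : Set G)
  isOpen_stabilizer : ∀ x : V, IsOpen (MulAction.stabilizer G x : Set G)

/-- A compactly generated (TDLC) group is hyperbolic if some Cayley-Abels graph of it is Gromov
hyperbolic.  The vertex set of a Cayley-Abels graph is in bijection with a set of cosets in `G`,
so that it is enough to look at graphs in the universe of `G`. -/
def IsHyperbolicGroup (G : Type u) [Group G] [TopologicalSpace G] : Prop :=
  (∃ K : Set G, IsCompact K ∧ Subgroup.closure K = ⊤) ∧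
    ∃ (V : Type u) (_ : MulAction G V) (X : SimpleGraph V),
      IsCayleyAbelsGraph G X ∧ IsGromovHyperbolic X

/-- A subgroup `H` of `G` is quasiconvex, with respect to a Cayley-Abels graph `X` of `G`, if some
`H`-orbit of a vertex of `X` is quasiconvex. -/
def IsQuasiconvexSubgroup {G : Type u} [Group G] (H : Subgroup G) {V : Type v} [MulAction G V]
    (X : SimpleGraph V) : Prop :=
  ∃ x : V, IsQuasiconvex X (MulAction.orbit H x)

/-- The data from which a Cayley-Abels graph of `G` is constructed: a compact open subgroup `U` and
a finite symmetric set `A` containing the identity with `UAU = AU` and `G = ⟨A⟩U`.  (Then `AU` is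
a compact generating set of `G`.) -/
structure IsCayleyAbelsData {G : Type u} [Group G] [TopologicalSpace G] (U : Subgroup G)
    (A : Set G) : Prop where
  isOpen : IsOpen (U : Set G)
  isCompact : IsCompact (U : Set G)
  finite : A.Finite
  one_mem : (1 : G) ∈ A
  symmetric : A⁻¹ = A
  mul_mul_eq : (U : Set G) * A * (U : Set G) = A * (U : Set G)
  generates : (Subgroup.closure A : Set G) * (U : Set G) = Set.univ

/-- The graph with vertices the cosets `gU` and edges `{gU, gaU}`, `g ∈ G`, `a ∈ A`. -/
def cosetGraph {G : Type u} [Group G] (U : Subgroup G) (A : Set G) : SimpleGraph (G ⧸ U) :=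
  SimpleGraph.fromRel fun x y => ∃ g : G, ∃ a ∈ A, x = (g : G ⧸ U) ∧ y = ((g * a : G) : G ⧸ U)

/-- The vertex map `h(U ∩ H) ↦ hU`. -/
def cosetMap {G : Type u} [Group G] (H U : Subgroup G) : H ⧸ (U.subgroupOf H) → G ⧸ U :=
  Quotient.map' (fun h : H => (h : G)) fun a b hab => by
    rw [QuotientGroup.leftRel_apply] at hab ⊢
    simpa [Subgroup.mem_subgroupOf] using hab

/-- The Gromov boundary of the graph on the cosets of `U`, based at the coset `U`. -/
abbrev Boundary {G : Type u} [Group G] (U : Subgroup G) (A : Set G) : Type u :=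
  GromovBoundary (cosetGraph U A) ((1 : G) : G ⧸ U)

end TDLC

-- Write `f` for the inclusion of Γ_H in Γ_G. Both graphs are hyperbolic, since Cayley-Abels graphs
-- of one group are quasi-isometric and hyperbolicity passes through quasi-isometric embeddings. The
-- link between the boundary map and quasiconvexity is a comparison of Gromov products `(f y | f z)`
-- in Γ_G with `(y | z)` in Γ_H.
--
-- If the Cannon-Thurston map is injective, bounded `(y | z)` forces bounded `(f y | f z)`
-- (`IsCannonThurstonMap.exists_gromovProduct_lt`): otherwise local finiteness gives subsequences
-- converging to boundary points ξ and η of H, continuity and the large products in Γ_G make their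
-- images equal, so ξ = η, and `(y | z)` would be unbounded. Translating by H moves this bound to
-- every base point. Hence the image of a Γ_H-geodesic stays coarsely between the images of its
-- ends, and, advancing by steps of length at most one, it passes near every point of the
-- Γ_G-geodesic (`isQuasiconvex_range`).
--
-- Conversely, `f` is metrically proper because H is closed in G. A proper Lipschitz map with
-- quasiconvex image is a quasi-isometric embedding (`IsQuasiconvex.exists_isQIEmbedding`). By
-- stability of quasi-geodesics, `(f y | f z)` then exceeds `(y | z)` by at most a constant, so
-- vertices tending to boundary points with the same image have large products already in Γ_H, and
-- the boundary points coincide.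

universe w

namespace GraphGeometry

/-! ### Gromov products, the four-point inequality and geodesics -/

section Basic

variable {V : Type u} {X : SimpleGraph V}

lemma dist_triangle_real (hX : X.Connected) (x y z : V) :
    (X.dist x z : ℝ) ≤ X.dist x y + X.dist y z := by
  exact_mod_cast hX.dist_triangle

lemma gromovProduct_comm (w x y : V) : gromovProduct X w x y = gromovProduct X w y x := by
  simp only [gromovProduct, X.dist_comm (u := x) (v := y)]
  ring

lemma gromovProduct_self (w x : V) : gromovProduct X w x x = X.dist w x := by
  simp [gromovProduct]

lemma gromovProduct_nonneg (hX : X.Connected) (w x y : V) : 0 ≤ gromovProduct X w x y := by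
  have := dist_triangle_real hX x w y
  rw [X.dist_comm (u := x) (v := w)] at this
  unfold gromovProduct
  linarith

lemma gromovProduct_le_dist_left (hX : X.Connected) (w x y : V) :
    gromovProduct X w x y ≤ X.dist w x := by
  have := dist_triangle_real hX w x y
  unfold gromovProduct
  linarith

lemma gromovProduct_le_dist_right (hX : X.Connected) (w x y : V) :
    gromovProduct X w x y ≤ X.dist w y := by
  rw [gromovProduct_comm]
  exact gromovProduct_le_dist_left hX w y x

lemma dist_sub_dist_le_gromovProduct (hX : X.Connected) (w x y : V) :
    (X.dist w x : ℝ) - X.dist x y ≤ gromovProduct X w x y := by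
  have := dist_triangle_real hX w y x
  rw [X.dist_comm (u := y) (v := x)] at this
  unfold gromovProduct
  linarith

lemma gromovProduct_le_add_dist (hX : X.Connected) (w x x' y : V) :
    gromovProduct X w x y ≤ gromovProduct X w x' y + X.dist x x' := by
  have h₁ := dist_triangle_real hX w x' x
  have h₂ := dist_triangle_real hX x' x y
  rw [X.dist_comm (u := x') (v := x)] at h₁ h₂
  unfold gromovProduct
  linarith

lemma gromovProduct_le_base_add_dist (hX : X.Connected) (w w' x y : V) :
    gromovProduct X w x y ≤ gromovProduct X w' x y + X.dist w w' := by
  have h₁ := dist_triangle_real hX w w' x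
  have h₂ := dist_triangle_real hX w w' y
  unfold gromovProduct
  linarith

lemma gromovProduct_eq_zero_of_between {p x y : V}
    (h : (X.dist x p : ℝ) + X.dist p y = X.dist x y) : gromovProduct X p x y = 0 := by
  rw [X.dist_comm (u := x) (v := p)] at h
  unfold gromovProduct
  linarith

/-- `X` satisfies the four-point inequality with constant `δ`. -/
def IsHyperbolicWith (X : SimpleGraph V) (δ : ℝ) : Prop :=
  ∀ w x y z : V,
    min (gromovProduct X w x y) (gromovProduct X w y z) - δ ≤ gromovProduct X w x z

lemma IsHyperbolicWith.nonneg {δ : ℝ} (h : IsHyperbolicWith X δ) (x : V) : 0 ≤ δ := by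
  have := h x x x x
  simp [gromovProduct_self] at this
  linarith

lemma IsHyperbolicWith.le_of_le {δ a : ℝ} (h : IsHyperbolicWith X δ) {w x y z : V}
    (h₁ : a ≤ gromovProduct X w x y) (h₂ : a ≤ gromovProduct X w y z) :
    a - δ ≤ gromovProduct X w x z :=
  (sub_le_sub_right (le_min h₁ h₂) δ).trans (h w x y z)

/-- The product inequality at `p`, cleared of denominators. Free of a base point, it bounds a
distance directly. -/
lemma IsHyperbolicWith.four_point {δ : ℝ} (h : IsHyperbolicWith X δ) (p q x y : V) :
    (X.dist p q : ℝ) + X.dist x y ≤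
      max ((X.dist p x : ℝ) + X.dist q y) (X.dist p y + X.dist q x) + 2 * δ := by
  have h₁ := h p x q y
  simp only [gromovProduct] at h₁
  rw [X.dist_comm (u := x) (v := q)] at h₁
  rcases min_cases (((X.dist p x : ℝ) + X.dist p q - X.dist q x) / 2)
    (((X.dist p q : ℝ) + X.dist p y - X.dist q y) / 2) with ⟨h₂, -⟩ | ⟨h₂, -⟩
  · rw [h₂] at h₁
    have := le_max_right ((X.dist p x : ℝ) + X.dist q y) (X.dist p y + X.dist q x)
    linarith
  · rw [h₂] at h₁
    have := le_max_left ((X.dist p x : ℝ) + X.dist q y) (X.dist p y + X.dist q x)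
    linarith

/-- The vertices `c 0, …, c n` form a geodesic. -/
def IsGeodesic (X : SimpleGraph V) (c : ℕ → V) (n : ℕ) : Prop :=
  ∀ i j, i ≤ j → j ≤ n → X.dist (c i) (c j) = j - i

lemma IsGeodesic.dist_real {c : ℕ → V} {n : ℕ} (hc : IsGeodesic X c n) {i j : ℕ} (hij : i ≤ j)
    (hj : j ≤ n) : (X.dist (c i) (c j) : ℝ) = j - i := by
  rw [hc i j hij hj, Nat.cast_sub hij]

/-- Along a walk, distances are at most differences of indices. When the length equals the distance
of the ends, the triangle inequality leaves no slack in any piece. -/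
lemma isGeodesic_getVert (hX : X.Connected) {x y : V} (p : X.Walk x y)
    (hp : p.length = X.dist x y) : IsGeodesic X p.getVert p.length := by
  have key : ∀ i j, i ≤ j → X.dist (p.getVert i) (p.getVert j) ≤ j - i := by
    intro i j hij
    induction j, hij using Nat.le_induction with
    | base => simp
    | succ j hij ih =>
      have h₁ : X.dist (p.getVert j) (p.getVert (j + 1)) ≤ 1 := by
        rcases lt_or_ge j p.length with h | h
        · exact (SimpleGraph.dist_eq_one_iff_adj.2 (p.adj_getVert_succ h)).le
        · rw [p.getVert_of_length_le h, p.getVert_of_length_le (h.trans j.le_succ)]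
          simp
      have := hX.dist_triangle (u := p.getVert i) (v := p.getVert j) (w := p.getVert (j + 1))
      omega
  intro i j hij hj
  have h₁ := key 0 i (Nat.zero_le i)
  have h₂ := key i j hij
  have h₃ := key j p.length hj
  rw [p.getVert_zero] at h₁
  rw [p.getVert_length] at h₃
  have h₄ := hX.dist_triangle (u := x) (v := p.getVert i) (w := y)
  have h₅ := hX.dist_triangle (u := p.getVert i) (v := p.getVert j) (w := y)
  omega

lemma exists_isGeodesic (hX : X.Connected) (x y : V) :
    ∃ c : ℕ → V, c 0 = x ∧ c (X.dist x y) = y ∧ IsGeodesic X c (X.dist x y) := by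
  obtain ⟨p, hp⟩ := hX.exists_walk_length_eq_dist x y
  refine ⟨p.getVert, p.getVert_zero, ?_, ?_⟩
  · rw [← hp, p.getVert_length]
  · rw [← hp]
    exact isGeodesic_getVert hX p hp

lemma IsGeodesic.between {c : ℕ → V} {n : ℕ} (hc : IsGeodesic X c n) {i : ℕ} (hi : i ≤ n) :
    (X.dist (c 0) (c i) : ℝ) + X.dist (c i) (c n) = X.dist (c 0) (c n) := by
  rw [hc.dist_real (Nat.zero_le i) hi, hc.dist_real hi le_rfl, hc.dist_real (Nat.zero_le n) le_rfl]
  ring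

/-- A point of a geodesic that is close to a given vertex. -/
lemma IsHyperbolicWith.exists_dist_geodesic_le {δ : ℝ} (h : IsHyperbolicWith X δ)
    (hX : X.Connected) {c : ℕ → V} {n : ℕ} (hc : IsGeodesic X c n) (p : V) :
    ∃ i ≤ n, (X.dist p (c i) : ℝ) ≤ gromovProduct X p (c 0) (c n) + 2 * δ + 1 := by
  -- At distance exactly `t` from `c 0`, the two terms of the maximum in the four-point inequality
  -- would coincide. Rounding `t` down costs at most 1.
  set t : ℝ := gromovProduct X (c 0) p (c n) with ht
  have hn : (X.dist (c 0) (c n) : ℝ) = n := by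
    rw [hc.dist_real (Nat.zero_le n) le_rfl]; simp
  have ht₀ : 0 ≤ t := gromovProduct_nonneg hX _ _ _
  have htn : t ≤ n := (gromovProduct_le_dist_right hX _ _ _).trans hn.le
  have hi : ⌊t⌋₊ ≤ n := Nat.floor_le_of_le htn
  refine ⟨⌊t⌋₊, hi, ?_⟩
  have h₁ := Nat.floor_le ht₀
  have h₂ := Nat.lt_floor_add_one t
  have h₃ := hc.dist_real (Nat.zero_le _) hi
  have h₄ := hc.dist_real hi le_rfl
  have h₅ := h.four_point p (c ⌊t⌋₊) (c 0) (c n)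
  rw [X.dist_comm (u := c ⌊t⌋₊) (v := c 0), h₃, h₄, hn] at h₅
  simp only [gromovProduct] at ht ⊢
  rw [X.dist_comm (u := c 0) (v := p), hn] at ht
  rw [hn]
  push_cast at h₅
  rcases max_cases ((X.dist p (c 0) : ℝ) + (n - ⌊t⌋₊)) (X.dist p (c n) + (⌊t⌋₊ - 0))
    with ⟨h₆, -⟩ | ⟨h₆, -⟩ <;> rw [h₆] at h₅ <;> linarith

/-- The Gromov product of the ends of a chain, in terms of those of its links. -/
lemma IsHyperbolicWith.chain {δ : ℝ} (h : IsHyperbolicWith X δ) (w : V) (c : ℕ → V) {a : ℝ} :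
    ∀ k n i : ℕ, 1 ≤ n → n ≤ 2 ^ k →
      (∀ j, i ≤ j → j < i + n → a ≤ gromovProduct X w (c j) (c (j + 1))) →
      a - k * δ ≤ gromovProduct X w (c i) (c (i + n)) := by
  have hδ := h.nonneg w
  intro k
  induction k with
  | zero =>
    intro n i h₁ h₂ hj
    obtain rfl : n = 1 := le_antisymm (by simpa using h₂) h₁
    simpa using hj i le_rfl (by omega)
  | succ k ih =>
    intro n i h₁ h₂ hj
    push_cast
    rcases le_or_gt n (2 ^ k) with hn | hn
    · have := ih n i h₁ hn hj
      linarith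
    · have h₃ := ih (2 ^ k) i Nat.one_le_two_pow le_rfl
        (fun j h₄ h₅ => hj j h₄ (by omega))
      have h₄ := ih (n - 2 ^ k) (i + 2 ^ k) (by omega) (by rw [pow_succ] at h₂; omega)
        (fun j h₄ h₅ => hj j (by omega) (by omega))
      rw [show i + 2 ^ k + (n - 2 ^ k) = i + n by omega] at h₄
      have := h.le_of_le h₃ h₄
      linarith

end Basic

/-- A quantity that is bounded by the logarithm of itself is bounded. -/
lemma exists_bound_of_le_log (a b e f : ℝ) (ha : 0 ≤ a) :
    ∃ R : ℝ, ∀ D : ℝ, (∀ k : ℕ, a * D + b ≤ 2 ^ k → D ≤ e + k * f) → D ≤ R := by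
  have hlim : Filter.Tendsto (fun k : ℕ => (k : ℝ) ^ 1 / (2 : ℝ) ^ k) Filter.atTop (nhds 0) :=
    tendsto_pow_const_div_const_pow_of_one_lt 1 one_lt_two
  have hlim' : Filter.Tendsto (fun k : ℕ => ((2 : ℝ) ^ k)⁻¹) Filter.atTop (nhds 0) := by
    exact tendsto_inv_atTop_zero.comp (tendsto_pow_atTop_atTop_of_one_lt (one_lt_two (α := ℝ)))
  have h := (hlim.const_mul (a * f)).add (hlim'.const_mul (a * (e + f) + b))
  simp only [mul_zero, add_zero] at h
  -- From `k₀` on, `2 ^ k` exceeds `a * (e + (k + 1) * f) + b`.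
  obtain ⟨k₀, hk₀⟩ := Filter.eventually_atTop.1 (h.eventually (gt_mem_nhds one_pos))
  refine ⟨e + k₀ * f, fun D hD => ?_⟩
  by_cases h₀ : a * D + b ≤ 2 ^ k₀
  · exact hD k₀ h₀
  exfalso
  obtain ⟨m, hm⟩ := pow_unbounded_of_one_lt (a * D + b) (one_lt_two (α := ℝ))
  have hex : ∃ m : ℕ, a * D + b ≤ 2 ^ m := ⟨m, hm.le⟩
  classical
  -- If the least admissible exponent is `k + 1 > k₀`, the bound on `D` that it yields makes `k`
  -- admissible as well.
  set m := Nat.find hex with hmdef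
  have hm₁ : a * D + b ≤ 2 ^ m := Nat.find_spec hex
  have hm₂ : k₀ < m := by
    by_contra hlt
    exact h₀ (hm₁.trans (pow_le_pow_right₀ one_le_two (not_lt.1 hlt)))
  obtain ⟨k, hmk⟩ : ∃ k, m = k + 1 := ⟨m - 1, by omega⟩
  rw [hmk] at hm₁
  have hm₃ : ¬ a * D + b ≤ 2 ^ k := Nat.find_min hex (by omega)
  have hm₄ := hD _ hm₁
  have hk := hk₀ k (by omega)
  have h2 : (0 : ℝ) < 2 ^ k := by positivity
  have hk' : a * f * k + (a * (e + f) + b) < 2 ^ k := by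
    have := mul_lt_mul_of_pos_right hk h2
    field_simp at this
    linarith
  push_cast at hm₄
  have := mul_le_mul_of_nonneg_left hm₄ ha
  apply hm₃
  nlinarith

end GraphGeometry

namespace GraphGeometry

/-! ### Stability of quasi-geodesics, and slim triangles -/

section Morse

variable {V : Type u} {X : SimpleGraph V}

/-- The vertices `c 0, …, c n` form a quasi-geodesic with constant `L`. -/
structure IsQuasigeodesic (X : SimpleGraph V) (L : ℝ) (c : ℕ → V) (n : ℕ) : Prop where
  step_le : ∀ i < n, (X.dist (c i) (c (i + 1)) : ℝ) ≤ L
  sub_le : ∀ i j, i ≤ j → j ≤ n → (j : ℝ) - i ≤ L * X.dist (c i) (c j) + L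

lemma IsQuasigeodesic.dist_le {L : ℝ} {c : ℕ → V} {n : ℕ} (hc : IsQuasigeodesic X L c n)
    (hX : X.Connected) {i j : ℕ} (hij : i ≤ j) (hj : j ≤ n) :
    (X.dist (c i) (c j) : ℝ) ≤ L * (j - i) := by
  induction j, hij using Nat.le_induction with
  | base => simp
  | succ j hij ih =>
    have h₁ := ih (by omega)
    have h₂ := hc.step_le j (by omega)
    have h₃ := dist_triangle_real hX (c i) (c j) (c (j + 1))
    push_cast
    linarith

/-- Consecutive points are far from `p` and at most `L` apart, so their product is at least `a - L`.
The distance of the ends controls the number of links, and `IsHyperbolicWith.chain` applies. -/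
lemma IsQuasigeodesic.le_gromovProduct {δ L a : ℝ} (h : IsHyperbolicWith X δ) {c : ℕ → V} {n : ℕ}
    (hX : X.Connected) (hL : 0 ≤ L)
    (hc : IsQuasigeodesic X L c n) (p : V) (ha : ∀ i ≤ n, a ≤ X.dist p (c i))
    {i j k : ℕ} (hi : i ≤ n) (hj : j ≤ n)
    (hk : L * X.dist (c i) (c j) + L + 1 ≤ 2 ^ k) :
    a - L - k * δ ≤ gromovProduct X p (c i) (c j) := by
  wlog hij : i ≤ j generalizing i j
  · rw [gromovProduct_comm]
    exact this hj hi (by rwa [X.dist_comm]) (le_of_not_ge hij)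
  have hδ := h.nonneg p
  have hk₀ : 0 ≤ k * δ := by positivity
  rcases hij.eq_or_lt with rfl | hlt
  · rw [gromovProduct_self]
    have := ha i hi
    linarith
  have hle : j - i ≤ 2 ^ k := by
    have h₁ := hc.sub_le i j hij hj
    have : ((j - i : ℕ) : ℝ) ≤ (2 ^ k : ℕ) := by
      rw [Nat.cast_sub hij]
      push_cast
      linarith
    exact_mod_cast this
  have := h.chain p c (a := a - L) k (j - i) i (by omega) hle (fun m h₁ h₂ => by
    have h₃ := dist_sub_dist_le_gromovProduct hX p (c m) (c (m + 1))
    have h₄ := hc.step_le m (by omega)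
    have h₅ := ha m (by omega)
    linarith)
  rwa [show i + (j - i) = j by omega] at this

/-- Geodesics stay close to the quasi-geodesics that have the same ends. -/
lemma exists_geodesic_near_quasigeodesic {δ L : ℝ} (hL : 0 ≤ L) (h : IsHyperbolicWith X δ)
    (hX : X.Connected) :
    ∃ R : ℝ, 0 ≤ R ∧ ∀ (c : ℕ → V) (n : ℕ), IsQuasigeodesic X L c n →
      ∀ (σ : ℕ → V) (m : ℕ), IsGeodesic X σ m → σ 0 = c 0 → σ m = c n →
        ∀ t ≤ m, ∃ i ≤ n, (X.dist (σ t) (c i) : ℝ) ≤ R := by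
  have hδ : 0 ≤ δ := h.nonneg (Classical.choice hX.nonempty)
  -- These constants encode the estimate behind `hDR`: if `L * (6 * D) + L + 1 ≤ 2 ^ k`, then `D ≤ L
  -- + 2 * δ + k * δ`.
  obtain ⟨R, hR⟩ := exists_bound_of_le_log (L * 6) (L + 1) (L + 2 * δ) δ (by positivity)
  refine ⟨max R 0, le_max_right _ _, fun c n hc σ m hσ h₀ hm t ht => ?_⟩
  have hmin : ∀ t, ∃ i ≤ n, ∀ j ≤ n, X.dist (σ t) (c i) ≤ X.dist (σ t) (c j) := by
    intro t
    obtain ⟨i, hi, hi'⟩ := Finset.exists_min_image (Finset.range (n + 1))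
      (fun i => X.dist (σ t) (c i)) ⟨0, by simp⟩
    exact ⟨i, by simpa [Nat.lt_succ_iff] using hi,
      fun j hj => hi' j (by simpa [Nat.lt_succ_iff] using hj)⟩
  choose f hf hf' using hmin
  -- `σ s` is a point of the geodesic farthest from the quasi-geodesic, and `D` is its distance to
  -- it.
  obtain ⟨s, hs, hs'⟩ := Finset.exists_max_image (Finset.range (m + 1))
      (fun t => X.dist (σ t) (c (f t))) ⟨0, by simp⟩
  replace hs : s ≤ m := by simpa [Nat.lt_succ_iff] using hs
  replace hs' : ∀ t ≤ m, X.dist (σ t) (c (f t)) ≤ X.dist (σ s) (c (f s)) :=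
    fun t ht => hs' t (by simpa [Nat.lt_succ_iff] using ht)
  set D := X.dist (σ s) (c (f s)) with hD
  have hDmin : ∀ i ≤ n, D ≤ X.dist (σ s) (c i) := hf' s
  -- points at distance `2 D` on both sides, or ends of the geodesic
  have left : ∃ t₁ ≤ s, s - t₁ ≤ 2 * D ∧ ∃ i ≤ n, X.dist (σ t₁) (c i) ≤ D ∧
      D + X.dist (σ t₁) (c i) ≤ X.dist (σ s) (σ t₁) := by
    rcases le_or_gt (2 * D) s with hle | hlt
    · refine ⟨s - 2 * D, by omega, by omega, f (s - 2 * D), hf _, hs' _ (by omega), ?_⟩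
      have h₁ := hs' (s - 2 * D) (by omega)
      have h₂ := hσ (s - 2 * D) s (by omega) hs
      rw [X.dist_comm (u := σ s), h₂]
      omega
    · refine ⟨0, by omega, by omega, 0, by omega, by simp [h₀], ?_⟩
      rw [h₀]
      simpa using hDmin 0 (by omega)
  have right : ∃ t₂, s ≤ t₂ ∧ t₂ ≤ m ∧ t₂ - s ≤ 2 * D ∧ ∃ i ≤ n, X.dist (σ t₂) (c i) ≤ D ∧
      D + X.dist (σ t₂) (c i) ≤ X.dist (σ s) (σ t₂) := by
    rcases le_or_gt (s + 2 * D) m with hle | hlt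
    · refine ⟨s + 2 * D, by omega, hle, by omega, f (s + 2 * D), hf _, hs' _ hle, ?_⟩
      have h₁ := hs' (s + 2 * D) hle
      have h₂ := hσ s (s + 2 * D) (by omega) hle
      omega
    · refine ⟨m, hs, le_rfl, by omega, n, le_rfl, by simp [hm], ?_⟩
      rw [hm]
      simpa using hDmin n le_rfl
  obtain ⟨t₁, ht₁, hd₁, i, hi, hi₁, hi₂⟩ := left
  obtain ⟨t₂, ht₂, htm, hd₂, j, hj, hj₁, hj₂⟩ := right
  have hij : X.dist (c i) (c j) ≤ 6 * D := by
    have h₁ := hX.dist_triangle (u := c i) (v := σ t₁) (w := c j)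
    have h₂ := hX.dist_triangle (u := σ t₁) (v := σ t₂) (w := c j)
    have h₃ := hσ t₁ t₂ (by omega) htm
    rw [X.dist_comm (u := c i) (v := σ t₁)] at h₁
    omega
  -- The detour `σ t₁`, `c i`, `c j`, `σ t₂` stays at distance about `D` from `σ s`, so its ends
  -- have product at `σ s` at least `D` up to a logarithmic loss. That product is 0, as `σ s` lies
  -- between them.
  have hDR : (D : ℝ) ≤ R := by
    refine hR D fun k hk => ?_
    have hij' : (X.dist (c i) (c j) : ℝ) ≤ 6 * D := by exact_mod_cast hij
    have h₁ := hc.le_gromovProduct h hX hL (σ s) (a := D)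
      (fun i hi => by exact_mod_cast hDmin i hi) hi hj (k := k) (by nlinarith)
    have h₂ : (D : ℝ) ≤ gromovProduct X (σ s) (σ t₁) (c i) := by
      have h₃ : (D : ℝ) + X.dist (σ t₁) (c i) ≤ X.dist (σ s) (σ t₁) := by exact_mod_cast hi₂
      have := dist_sub_dist_le_gromovProduct hX (σ s) (σ t₁) (c i)
      linarith
    have h₃ : (D : ℝ) ≤ gromovProduct X (σ s) (c j) (σ t₂) := by
      have h₃ : (D : ℝ) + X.dist (σ t₂) (c j) ≤ X.dist (σ s) (σ t₂) := by exact_mod_cast hj₂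
      have := dist_sub_dist_le_gromovProduct hX (σ s) (σ t₂) (c j)
      rw [gromovProduct_comm]
      linarith
    have hk₀ : 0 ≤ k * δ := by positivity
    have h₄ := h.le_of_le (a := D - L - k * δ) (by linarith) h₁
    have h₅ := h.le_of_le (a := D - L - k * δ - δ) h₄ (by linarith)
    have h₆ : gromovProduct X (σ s) (σ t₁) (σ t₂) = 0 := by
      apply gromovProduct_eq_zero_of_between
      rw [hσ.dist_real ht₁ hs, hσ.dist_real ht₂ htm, hσ.dist_real (ht₁.trans ht₂) htm]
      ring
    rw [h₆] at h₅
    linarith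
  refine ⟨f t, hf t, le_trans ?_ (hDR.trans (le_max_left _ _))⟩
  exact_mod_cast hs' t ht

/-- A quasi-geodesic passes close to all points that are coarsely between its ends. -/
lemma exists_quasigeodesic_near {δ L : ℝ} (hL : 0 ≤ L) (h : IsHyperbolicWith X δ)
    (hX : X.Connected) :
    ∃ R : ℝ, 0 ≤ R ∧ ∀ (c : ℕ → V) (n : ℕ), IsQuasigeodesic X L c n →
      ∀ p : V, ∃ i ≤ n, (X.dist p (c i) : ℝ) ≤ gromovProduct X p (c 0) (c n) + R := by
  have hδ : 0 ≤ δ := h.nonneg (Classical.choice hX.nonempty)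
  obtain ⟨R, hR, hnear⟩ := exists_geodesic_near_quasigeodesic hL h hX
  refine ⟨R + 2 * δ + 1, by positivity, fun c n hc p => ?_⟩
  obtain ⟨σ, h₀, hm, hσ⟩ := exists_isGeodesic hX (c 0) (c n)
  obtain ⟨t, ht, hpt⟩ := h.exists_dist_geodesic_le hX hσ p
  obtain ⟨i, hi, hit⟩ := hnear c n hc σ _ hσ h₀ hm t ht
  refine ⟨i, hi, ?_⟩
  rw [h₀, hm] at hpt
  have := dist_triangle_real hX p (σ t) (c i)
  linarith

/-- All points of a quasi-geodesic are coarsely between its ends. -/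
lemma exists_gromovProduct_quasigeodesic_le {δ L : ℝ} (hL : 0 ≤ L) (h : IsHyperbolicWith X δ)
    (hX : X.Connected) :
    ∃ K : ℝ, 0 ≤ K ∧ ∀ (c : ℕ → V) (n : ℕ), IsQuasigeodesic X L c n →
      ∀ i ≤ n, gromovProduct X (c i) (c 0) (c n) ≤ K := by
  obtain ⟨R, hR, hnear⟩ := exists_geodesic_near_quasigeodesic hL h hX
  refine ⟨R + L * (L * (2 * R + 1) + L), by positivity, fun c n hc i hi => ?_⟩
  obtain ⟨σ, h₀, hm, hσ⟩ := exists_isGeodesic hX (c 0) (c n)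
  set m := X.dist (c 0) (c n)
  -- A discrete connectedness argument: somewhere the geodesic passes from being near the part of
  -- `c` before `i` to being near the part after `i`. The bound `2 * R + 1` counts two approaches
  -- and one step. The arc from `c j` to `c k` is then short, and it contains `c i`.
  have key : ∃ t ≤ m, ∃ j ≤ i, (X.dist (σ t) (c j) : ℝ) ≤ R ∧
      ∃ k, i ≤ k ∧ k ≤ n ∧ (X.dist (c j) (c k) : ℝ) ≤ 2 * R + 1 := by
    by_contra hno
    push Not at hno
    have hall : ∀ t ≤ m, ∃ j ≤ i, (X.dist (σ t) (c j) : ℝ) ≤ R := by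
      intro t
      induction t with
      | zero => exact fun _ => ⟨0, Nat.zero_le _, by simpa [h₀] using hR⟩
      | succ t ih =>
        intro ht
        obtain ⟨j, hj, hjt⟩ := ih (by omega)
        obtain ⟨k, hk, hkt⟩ := hnear c n hc σ m hσ h₀ hm (t + 1) ht
        by_contra hcon
        push Not at hcon
        have hik : i ≤ k := by
          by_contra hki
          exact absurd hkt (not_le.2 (hcon k (by omega)))
        have h₁ := hno t (by omega) j hj hjt k hik hk
        have h₂ := dist_triangle_real hX (c j) (σ t) (c k)
        have h₃ := dist_triangle_real hX (σ t) (σ (t + 1)) (c k)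
        have h₄ := hσ.dist_real t.le_succ ht
        rw [X.dist_comm (u := c j) (v := σ t)] at h₂
        push_cast at h₄
        linarith
    obtain ⟨j, hj, hjt⟩ := hall m le_rfl
    have h₁ := hno m le_rfl j hj hjt n hi le_rfl
    rw [hm, X.dist_comm] at hjt
    linarith
  obtain ⟨t, ht, j, hj, hjt, k, hik, hkn, hjk⟩ := key
  have h₁ := hc.sub_le j k (hj.trans hik) hkn
  have h₂ := hc.dist_le hX hj hi
  have h₃ : (i : ℝ) - j ≤ L * (2 * R + 1) + L := by
    have : (i : ℝ) ≤ k := by exact_mod_cast hik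
    nlinarith
  have h₄ : (X.dist (c j) (c i) : ℝ) ≤ L * (L * (2 * R + 1) + L) :=
    h₂.trans (mul_le_mul_of_nonneg_left h₃ hL)
  have h₅ : gromovProduct X (σ t) (c 0) (c n) = 0 := by
    rw [← h₀, ← hm]
    exact gromovProduct_eq_zero_of_between (hσ.between ht)
  have h₆ := gromovProduct_le_base_add_dist hX (c i) (σ t) (c 0) (c n)
  have h₇ := dist_triangle_real hX (σ t) (c j) (c i)
  rw [X.dist_comm (u := σ t) (v := c i)] at h₇
  linarith

/-- A graph in which the triangles are slim satisfies the four-point inequality. -/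
lemma isGromovHyperbolic_of_slim (hX : X.Connected) {s : ℝ} (hs : 0 ≤ s)
    (hslim : ∀ x y z p : V, (X.dist x p : ℝ) + X.dist p y = X.dist x y →
      ∃ q, ((X.dist x q : ℝ) + X.dist q z = X.dist x z ∨
        (X.dist z q : ℝ) + X.dist q y = X.dist z y) ∧ (X.dist p q : ℝ) ≤ s) :
    IsGromovHyperbolic X := by
  -- Coarse converse of the fact that `(x | y)_w` is at most the distance from `w` to any point
  -- between `x` and `y`.
  have near : ∀ w x y : V, ∃ p, (X.dist x p : ℝ) + X.dist p y = X.dist x y ∧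
      (X.dist w p : ℝ) ≤ gromovProduct X w x y + (2 * s + 1) := by
    intro w x y
    obtain ⟨c, h₀, hm, hc⟩ := exists_isGeodesic hX x y
    set m := X.dist x y
    -- The sides `[x, w]` and `[w, y]` together come near all of the geodesic. Where it leaves the
    -- first for the second, both are close; that step accounts for `s + 1`.
    have key : ∃ t ≤ m, ∃ q r, (X.dist x q : ℝ) + X.dist q w = X.dist x w ∧
        (X.dist w r : ℝ) + X.dist r y = X.dist w y ∧
        (X.dist (c t) q : ℝ) ≤ s ∧ (X.dist (c t) r : ℝ) ≤ s + 1 := by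
      by_contra hno
      push Not at hno
      have hall : ∀ t ≤ m, ∃ q, (X.dist x q : ℝ) + X.dist q w = X.dist x w ∧
          (X.dist (c t) q : ℝ) ≤ s := by
        intro t
        induction t with
        | zero => exact fun _ => ⟨x, by simp, by simpa [h₀] using hs⟩
        | succ t ih =>
          intro ht
          obtain ⟨q, hq, hq'⟩ := ih (by omega)
          obtain ⟨r, hr | hr, hr'⟩ := hslim x y w (c (t + 1)) (by
            rw [← h₀, ← hm]; exact hc.between ht)
          · exact ⟨r, hr, hr'⟩
          · exfalso
            have h₁ := hno t (by omega) q r hq hr hq'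
            have h₃ := dist_triangle_real hX (c t) (c (t + 1)) r
            have h₄ := hc.dist_real t.le_succ ht
            push_cast at h₄
            linarith
      obtain ⟨q, hq, hq'⟩ := hall m le_rfl
      have h₁ := hno m le_rfl q y hq (by simp) hq'
      rw [hm] at h₁
      simp at h₁
      linarith
    obtain ⟨t, ht, q, r, hq, hr, hqt, hrt⟩ := key
    have h₁ := hc.between ht
    rw [h₀, hm] at h₁
    refine ⟨c t, h₁, ?_⟩
    have h₂ := dist_triangle_real hX w q (c t)
    have h₃ := dist_triangle_real hX w r (c t)
    have h₄ := dist_triangle_real hX x q (c t)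
    have h₅ := dist_triangle_real hX (c t) r y
    rw [X.dist_comm (u := q) (v := c t)] at h₂ h₄
    rw [X.dist_comm (u := r) (v := c t)] at h₃
    rw [X.dist_comm (u := x) (v := w), X.dist_comm (u := q) (v := w)] at hq
    unfold gromovProduct
    linarith
  refine ⟨s + (2 * s + 1), fun w x y z => ?_⟩
  obtain ⟨p, hp, hp'⟩ := near w x z
  obtain ⟨q, hq, hpq⟩ := hslim x z y p hp
  have h₁ := dist_triangle_real hX w p q
  rcases hq with hq | hq
  · have h₂ := gromovProduct_le_base_add_dist hX w q x y
    rw [gromovProduct_eq_zero_of_between hq] at h₂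
    have := min_le_left (gromovProduct X w x y) (gromovProduct X w y z)
    linarith
  · have h₂ := gromovProduct_le_base_add_dist hX w q y z
    rw [gromovProduct_eq_zero_of_between hq] at h₂
    have := min_le_right (gromovProduct X w x y) (gromovProduct X w y z)
    linarith

end Morse

/-! ### Quasi-isometric embeddings: hyperbolicity and quasiconvexity -/

section QuasiIsometry

variable {V : Type u} {W : Type v} {X : SimpleGraph V} {Y : SimpleGraph W}

/-- `f` is a quasi-isometric embedding with constant `L`. -/
structure IsQIEmbedding (X : SimpleGraph V) (Y : SimpleGraph W) (L : ℝ) (f : V → W) : Prop where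
  dist_le : ∀ x y, (Y.dist (f x) (f y) : ℝ) ≤ L * X.dist x y + L
  le_dist : ∀ x y, (X.dist x y : ℝ) ≤ L * Y.dist (f x) (f y) + L

lemma IsQIEmbedding.const_nonneg {L : ℝ} {f : V → W} (hf : IsQIEmbedding X Y L f) (x : V) :
    0 ≤ L := by
  simpa using hf.dist_le x x

lemma IsQIEmbedding.isQuasigeodesic {L : ℝ} {f : V → W} (hf : IsQIEmbedding X Y L f)
    {c : ℕ → V} {n : ℕ} (hc : IsGeodesic X c n) : IsQuasigeodesic Y (2 * L) (f ∘ c) n where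
  step_le i hi := by
    have h₁ := hf.dist_le (c i) (c (i + 1))
    rw [hc.dist_real i.le_succ hi] at h₁
    push_cast at h₁
    simp only [Function.comp_apply]
    linarith
  sub_le i j hij hj := by
    have h₁ := hf.le_dist (c i) (c j)
    rw [hc.dist_real hij hj] at h₁
    have h₂ := hf.const_nonneg (c i)
    have h₃ : (0 : ℝ) ≤ L * Y.dist (f (c i)) (f (c j)) := by positivity
    simp only [Function.comp_apply]
    linarith

/-- The image of a vertex of a geodesic is coarsely between the images of the ends. -/
lemma IsQIEmbedding.exists_gromovProduct_le {δ L : ℝ} {f : V → W} (hf : IsQIEmbedding X Y L f)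
    (hX : X.Connected) (hY : Y.Connected) (h : IsHyperbolicWith Y δ) :
    ∃ K : ℝ, 0 ≤ K ∧ ∀ (c : ℕ → V) (n : ℕ), IsGeodesic X c n → ∀ i ≤ n,
      gromovProduct Y (f (c i)) (f (c 0)) (f (c n)) ≤ K := by
  have hL := hf.const_nonneg (Classical.choice hX.nonempty)
  obtain ⟨K, hK, hle⟩ := exists_gromovProduct_quasigeodesic_le (L := 2 * L) (by positivity) h hY
  exact ⟨K, hK, fun c n hc i hi => hle _ n (hf.isQuasigeodesic hc) i hi⟩

lemma exists_geodesic_through (hX : X.Connected) {x y p : V}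
    (h : (X.dist x p : ℝ) + X.dist p y = X.dist x y) :
    ∃ c n, IsGeodesic X c n ∧ c 0 = x ∧ c n = y ∧ ∃ i ≤ n, c i = p := by
  obtain ⟨r, hr⟩ := hX.exists_walk_length_eq_dist x p
  obtain ⟨s, hs⟩ := hX.exists_walk_length_eq_dist p y
  have hlen : (r.append s).length = X.dist x y := by
    rw [SimpleGraph.Walk.length_append, hr, hs]
    exact_mod_cast h
  refine ⟨(r.append s).getVert, _, isGeodesic_getVert hX _ hlen, by simp,
    SimpleGraph.Walk.getVert_length _, r.length, by simp, ?_⟩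
  simp [SimpleGraph.Walk.getVert_append]

/-- A graph that embeds quasi-isometrically into a hyperbolic graph is hyperbolic. -/
lemma IsQIEmbedding.isGromovHyperbolic {L : ℝ} {f : V → W} (hf : IsQIEmbedding X Y L f)
    (hX : X.Connected) (hY : Y.Connected) (h : IsGromovHyperbolic Y) : IsGromovHyperbolic X := by
  obtain ⟨δ, h⟩ := h
  replace h : IsHyperbolicWith Y δ := h
  have hL := hf.const_nonneg (Classical.choice hX.nonempty)
  have hδ := h.nonneg (Classical.choice hY.nonempty)
  obtain ⟨K, hK, hK'⟩ := hf.exists_gromovProduct_le hX hY h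
  obtain ⟨R, hR, hR'⟩ := exists_quasigeodesic_near (L := 2 * L) (by positivity) h hY
  -- The image of `p` has product at most `K` with the ends of its side, hence at most `K + δ` with
  -- those of one of the other two sides. The quasi-geodesic image of that side passes within `K + δ
  -- + R`, and `le_dist` pulls this back.
  refine isGromovHyperbolic_of_slim hX (s := L * (K + δ + R) + L) (by positivity) ?_
  intro x y z p hp
  obtain ⟨c, n, hc, rfl, rfl, i, hi, rfl⟩ := exists_geodesic_through hX hp
  have near : ∀ a b, gromovProduct Y (f (c i)) (f a) (f b) ≤ K + δ →
      ∃ q, (X.dist a q : ℝ) + X.dist q b = X.dist a b ∧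
        (X.dist (c i) q : ℝ) ≤ L * (K + δ + R) + L := by
    intro a b hab
    obtain ⟨σ, h₀, hm, hσ⟩ := exists_isGeodesic hX a b
    obtain ⟨j, hj, hj'⟩ := hR' _ _ (hf.isQuasigeodesic hσ) (f (c i))
    simp only [Function.comp_apply, h₀, hm] at hj'
    refine ⟨σ j, ?_, (hf.le_dist _ _).trans ?_⟩
    · have := hσ.between hj
      rwa [h₀, hm] at this
    · gcongr
      linarith
  have h₁ := hK' c n hc i hi
  have h₂ := h (f (c i)) (f (c 0)) (f z) (f (c n))
  rcases min_cases (gromovProduct Y (f (c i)) (f (c 0)) (f z))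
    (gromovProduct Y (f (c i)) (f z) (f (c n))) with ⟨h₃, -⟩ | ⟨h₃, -⟩
  · obtain ⟨q, hq, hq'⟩ := near (c 0) z (by linarith)
    exact ⟨q, Or.inl hq, hq'⟩
  · obtain ⟨q, hq, hq'⟩ := near z (c n) (by linarith)
    exact ⟨q, Or.inr hq, hq'⟩

/-- Quasiconvexity can be tested after a quasi-isometric embedding. -/
lemma IsQIEmbedding.isQuasiconvex {L M : ℝ} {f : V → W} (hf : IsQIEmbedding X Y L f)
    (hX : X.Connected) (hY : Y.Connected) (h : IsGromovHyperbolic Y) {S : Set V} {T : Set W}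
    (hST : ∀ x ∈ S, ∃ y ∈ T, (Y.dist (f x) y : ℝ) ≤ M)
    (hTS : ∀ y ∈ T, ∃ x ∈ S, (Y.dist (f x) y : ℝ) ≤ M)
    (hT : IsQuasiconvex Y T) : IsQuasiconvex X S := by
  obtain ⟨δ, h⟩ := h
  replace h : IsHyperbolicWith Y δ := h
  have hL := hf.const_nonneg (Classical.choice hX.nonempty)
  obtain ⟨K, hK, hK'⟩ := hf.exists_gromovProduct_le hX hY h
  obtain ⟨D, hD⟩ := hT
  -- In order: `K + 2 * M` after moving the ends into `T`, `2 * δ + 1` to reach the geodesic, `D` to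
  -- reach `T`, `M` to return to the image of `S`. The outer `L` pulls the distance back to `X`.
  refine ⟨⌈L * (K + 2 * M + 2 * δ + 1 + D + M) + L⌉₊, fun a ha b hb p hp z hz => ?_⟩
  obtain ⟨i, rfl, hi⟩ := SimpleGraph.Walk.mem_support_iff_exists_getVert.1 hz
  have h₁ := hK' p.getVert p.length (isGeodesic_getVert hX p hp) i hi
  rw [p.getVert_zero, p.getVert_length] at h₁
  set z := p.getVert i
  obtain ⟨a', ha', haa'⟩ := hST a ha
  obtain ⟨b', hb', hbb'⟩ := hST b hb
  have h₂ : gromovProduct Y (f z) a' b' ≤ K + 2 * M := by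
    have h₃ := gromovProduct_le_add_dist hY (f z) a' (f a) b'
    have h₄ := gromovProduct_le_add_dist hY (f z) b' (f b) (f a)
    rw [gromovProduct_comm, gromovProduct_comm (x := f b)] at h₄
    rw [Y.dist_comm] at h₃ h₄
    linarith
  obtain ⟨q, hq⟩ := hY.exists_walk_length_eq_dist a' b'
  obtain ⟨j, hj, hj'⟩ := h.exists_dist_geodesic_le hY (isGeodesic_getVert hY q hq) (f z)
  rw [q.getVert_zero, q.getVert_length] at hj'
  obtain ⟨t, ht, htd⟩ := hD a' ha' b' hb' q hq (q.getVert j) (q.getVert_mem_support j)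
  obtain ⟨s, hs, hst⟩ := hTS t ht
  refine ⟨s, hs, ?_⟩
  have h₅ := dist_triangle_real hY (f z) (q.getVert j) (f s)
  have h₆ := dist_triangle_real hY (q.getVert j) t (f s)
  rw [Y.dist_comm (u := t)] at h₆
  have h₇ : (Y.dist (q.getVert j) t : ℝ) ≤ D := by exact_mod_cast htd
  have h₈ := hf.le_dist z s
  have h₉ : L * (Y.dist (f z) (f s) : ℝ) ≤ L * (K + 2 * M + 2 * δ + 1 + D + M) :=
    mul_le_mul_of_nonneg_left (by linarith) hL
  have h₁₀ := Nat.le_ceil (L * (K + 2 * M + 2 * δ + 1 + D + M) + L)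
  have h₁₁ := (h₈.trans (add_le_add_left h₉ L)).trans h₁₀
  exact_mod_cast h₁₁

end QuasiIsometry

end GraphGeometry

namespace GraphGeometry

/-! ### The boundary, its neighbourhoods, and Cannon-Thurston maps -/

section Boundary

variable {V : Type u} {X : SimpleGraph V} {x₀ : V}

lemma GeodesicRay.dist_eq (γ : GeodesicRay X x₀) {m n : ℕ} (h : m ≤ n) :
    X.dist (γ.toFun m) (γ.toFun n) = n - m := by
  obtain ⟨k, rfl⟩ := Nat.exists_eq_add_of_le h
  rw [SimpleGraph.dist, γ.geodesic]
  simp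

lemma GeodesicRay.dist_base (γ : GeodesicRay X x₀) (n : ℕ) : X.dist x₀ (γ.toFun n) = n := by
  have := γ.dist_eq (Nat.zero_le n)
  rwa [γ.start] at this

lemma GeodesicRay.gromovProduct_eq (γ : GeodesicRay X x₀) (m n : ℕ) :
    gromovProduct X x₀ (γ.toFun m) (γ.toFun n) = min (m : ℝ) n := by
  wlog h : m ≤ n generalizing m n
  · rw [gromovProduct_comm, min_comm]
    exact this n m (le_of_not_ge h)
  have h' : (m : ℝ) ≤ n := by exact_mod_cast h
  rw [gromovProduct, γ.dist_base, γ.dist_base, γ.dist_eq h, min_eq_left h', Nat.cast_sub h]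
  ring

/-- Both points are compared through far points of the two rays that are `D` apart. Going far enough
out absorbs `D`, so that only two uses of hyperbolicity are lost. -/
lemma Asymptotic.le_gromovProduct {δ : ℝ} (h : IsHyperbolicWith X δ) (hX : X.Connected)
    {γ γ' : GeodesicRay X x₀} (hγ : Asymptotic γ γ') (m n : ℕ) :
    min (m : ℝ) n - 2 * δ ≤ gromovProduct X x₀ (γ.toFun m) (γ'.toFun n) := by
  have hδ := h.nonneg x₀
  obtain ⟨D, hD, -⟩ := hγ
  set M := max m n + D
  obtain ⟨M', hM'⟩ := hD M
  have hdist : X.dist (γ.toFun M) (γ'.toFun M') ≤ D := by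
    rw [← (hX _ _).coe_dist_eq_edist] at hM'
    exact_mod_cast hM'
  have h₁ := hX.dist_triangle (u := x₀) (v := γ'.toFun M') (w := γ.toFun M)
  rw [γ.dist_base, γ'.dist_base, X.dist_comm] at h₁
  have hm : (m : ℝ) ≤ max (m : ℝ) n := le_max_left _ _
  have hn : (n : ℝ) ≤ max (m : ℝ) n := le_max_right _ _
  have hM : (M : ℝ) = max (m : ℝ) n + D := by simp [M]
  have hMn : n ≤ M' := by omega
  have hmin : min (m : ℝ) n ≤ max (m : ℝ) n := min_le_max
  have h₂ : min (m : ℝ) n ≤ gromovProduct X x₀ (γ.toFun m) (γ.toFun M) := by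
    rw [γ.gromovProduct_eq]
    refine le_min (min_le_left _ _) ?_
    rw [hM]
    have : (0 : ℝ) ≤ D := by positivity
    linarith
  have h₃ : min (m : ℝ) n ≤ gromovProduct X x₀ (γ.toFun M) (γ'.toFun M') := by
    have h₄ := dist_sub_dist_le_gromovProduct hX x₀ (γ.toFun M) (γ'.toFun M')
    have h₅ : (X.dist (γ.toFun M) (γ'.toFun M') : ℝ) ≤ D := by exact_mod_cast hdist
    rw [γ.dist_base] at h₄
    linarith
  have h₄ : min (m : ℝ) n ≤ gromovProduct X x₀ (γ'.toFun M') (γ'.toFun n) := by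
    rw [γ'.gromovProduct_eq]
    refine le_min ((min_le_right _ _).trans ?_) (min_le_right _ _)
    exact_mod_cast hMn
  have h₅ := h.le_of_le h₂ h₃
  have h₆ := h.le_of_le (a := min (m : ℝ) n - δ) h₅ (by linarith)
  linarith

/-- A product of at least `k` far out forces `(γ k | γ' k) ≥ k - 2 * δ`, which means that the rays
are `4 * δ`-close at time `k`. -/
lemma asymptotic_of_gromovProduct {δ : ℝ} (h : IsHyperbolicWith X δ) (hX : X.Connected)
    {γ γ' : GeodesicRay X x₀}
    (hγ : ∀ R : ℝ, ∃ m n : ℕ, R ≤ gromovProduct X x₀ (γ.toFun m) (γ'.toFun n)) :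
    Asymptotic γ γ' := by
  have key : ∀ k : ℕ, X.edist (γ.toFun k) (γ'.toFun k) ≤ (⌈4 * δ⌉₊ : ℕ) := by
    intro k
    rw [← (hX _ _).coe_dist_eq_edist]
    suffices (X.dist (γ.toFun k) (γ'.toFun k) : ℝ) ≤ 4 * δ by
      exact_mod_cast this.trans (Nat.le_ceil _)
    obtain ⟨m, n, hmn⟩ := hγ k
    have h₁ := (gromovProduct_le_dist_left hX _ _ _).trans' hmn
    have h₂ := (gromovProduct_le_dist_right hX _ _ _).trans' hmn
    rw [GeodesicRay.dist_base] at h₁ h₂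
    have h₃ : (k : ℝ) ≤ gromovProduct X x₀ (γ.toFun k) (γ.toFun m) := by
      rw [γ.gromovProduct_eq]
      exact le_min le_rfl h₁
    have h₄ : (k : ℝ) ≤ gromovProduct X x₀ (γ'.toFun n) (γ'.toFun k) := by
      rw [γ'.gromovProduct_eq]
      exact le_min h₂ le_rfl
    have hδ := h.nonneg x₀
    have h₅ := h.le_of_le h₃ hmn
    have h₆ := h.le_of_le (a := k - δ) h₅ (by linarith)
    rw [gromovProduct, GeodesicRay.dist_base, GeodesicRay.dist_base] at h₆
    linarith
  exact ⟨_, fun m => ⟨m, key m⟩, fun m => ⟨m, key m⟩⟩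

namespace Compactification

lemma represents_mk (γ : GeodesicRay X x₀) :
    Represents (ideal (Quotient.mk (raySetoid X x₀) γ)) γ.toFun :=
  ⟨γ, rfl, rfl⟩

/-- Two sequences that represent the same boundary point have large Gromov products. -/
lemma Represents.le_gromovProduct {δ : ℝ} (h : IsHyperbolicWith X δ) (hX : X.Connected)
    {ξ : GromovBoundary X x₀} {s s' : ℕ → V} (hs : Represents (ideal ξ) s)
    (hs' : Represents (ideal ξ) s') (m n : ℕ) :
    min (m : ℝ) n - 2 * δ ≤ gromovProduct X x₀ (s m) (s' n) := by
  obtain ⟨γ, hγ, rfl⟩ := hs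
  obtain ⟨γ', hγ', rfl⟩ := hs'
  exact Asymptotic.le_gromovProduct h hX (Quotient.exact (hγ.trans hγ'.symm)) m n

lemma nbhd_antitone (ξ : GromovBoundary X x₀) {R R' : ℝ} (h : R ≤ R') : nbhd ξ R' ⊆ nbhd ξ R := by
  rintro y ⟨s, t, hs, ht, N, hN⟩
  exact ⟨s, t, hs, ht, N, fun m hm n hn => h.trans (hN m hm n hn)⟩

lemma self_mem_nbhd (ξ : GromovBoundary X x₀) (R : ℝ) : ideal ξ ∈ nbhd ξ R := by
  obtain ⟨γ, rfl⟩ := Quotient.exists_rep ξ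
  refine ⟨_, _, represents_mk γ, represents_mk γ, ⌈R⌉₊, fun m hm n hn => ?_⟩
  rw [γ.gromovProduct_eq]
  exact le_min (Nat.ceil_le.1 hm) (Nat.ceil_le.1 hn)

/-- Of the loss `4 * δ`, half comes from the change of ray representing `ζ` and half from two uses
of hyperbolicity. -/
lemma nbhd_trans {δ : ℝ} (h : IsHyperbolicWith X δ) (hX : X.Connected)
    {ζ η : GromovBoundary X x₀} {y : Compactification X x₀} {R : ℝ} (hy : y ∈ nbhd ζ R)
    (hζ : ideal ζ ∈ nbhd η R) : y ∈ nbhd η (R - 4 * δ) := by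
  have hδ := h.nonneg x₀
  obtain ⟨s, t, hs, ht, N, hN⟩ := hy
  obtain ⟨t', r, ht', hr, N', hN'⟩ := hζ
  refine ⟨s, r, hs, hr, max N N', fun m hm n hn => ?_⟩
  set k := max (max N N') ⌈R⌉₊
  have hk : R ≤ k := (Nat.le_ceil R).trans (by exact_mod_cast le_max_right _ _)
  have h₁ := hN m ((le_max_left _ _).trans hm) k ((le_max_left _ _).trans (le_max_left _ _))
  have h₂ := hN' k ((le_max_right _ _).trans (le_max_left _ _)) n ((le_max_right _ _).trans hn)
  have h₃ := ht.le_gromovProduct h hX ht' k k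
  rw [min_self] at h₃
  have h₄ := h.le_of_le (a := R - 2 * δ) (by linarith) (h₃.trans' (by linarith))
  have h₅ := h.le_of_le (a := R - 3 * δ) (h₄.trans' (by linarith)) (h₂.trans' (by linarith))
  linarith

/-- The sets `nbhd ξ R` are neighbourhoods of `ξ`. -/
lemma exists_isOpen_subset_nbhd {δ : ℝ} (h : IsHyperbolicWith X δ) (hX : X.Connected)
    (ξ : GromovBoundary X x₀) (R : ℝ) :
    ∃ O : Set (Compactification X x₀), IsOpen O ∧ ideal ξ ∈ O ∧ O ⊆ nbhd ξ R := by
  have hδ := h.nonneg x₀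
  -- The candidate is the interior: vertices are isolated, so only boundary points need room. It is
  -- open because radius `R' + 4 * δ` pays for `nbhd_trans`.
  refine ⟨{y | y ∈ nbhd ξ R ∧ ∀ ζ, y = ideal ζ → ∃ R', nbhd ζ R' ⊆ nbhd ξ R}, ?_, ?_,
    fun y hy => hy.1⟩
  · rintro η ⟨-, hη⟩
    obtain ⟨R', hR'⟩ := hη η rfl
    refine ⟨R' + 4 * δ, fun y hy =>
      ⟨hR' (nbhd_antitone η (by linarith) hy), ?_⟩⟩
    rintro ζ rfl
    refine ⟨R' + 4 * δ, fun y' hy' => hR' ?_⟩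
    have := nbhd_trans h hX hy' hy
    rwa [add_sub_cancel_right] at this
  · exact ⟨self_mem_nbhd ξ R, fun ζ hζ => by cases hζ; exact ⟨R, subset_rfl⟩⟩

lemma vertex_mem_nbhd_mk {γ : GeodesicRay X x₀} {x : V} {R : ℝ} {N : ℕ}
    (h : ∀ n ≥ N, R ≤ gromovProduct X x₀ x (γ.toFun n)) :
    vertex x ∈ nbhd (Quotient.mk (raySetoid X x₀) γ) R :=
  ⟨fun _ => x, _, fun _ => rfl, represents_mk γ, N, fun _ _ n hn => h n hn⟩

/-- Makes the existential definition of `nbhd` usable along a prescribed ray: `2 * δ` for changing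
the ray, `δ` for one use of hyperbolicity. -/
lemma le_gromovProduct_of_vertex_mem_nbhd {δ : ℝ} (h : IsHyperbolicWith X δ) (hX : X.Connected)
    {γ : GeodesicRay X x₀} {x : V} {R : ℝ}
    (hx : vertex x ∈ nbhd (Quotient.mk (raySetoid X x₀) γ) R) {n : ℕ} (hn : R ≤ n) :
    R - 3 * δ ≤ gromovProduct X x₀ x (γ.toFun n) := by
  have hδ := h.nonneg x₀
  obtain ⟨s, t, hs, ht, N, hN⟩ := hx
  set k := max N ⌈R⌉₊
  have hk : R ≤ k := (Nat.le_ceil R).trans (by exact_mod_cast le_max_right _ _)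
  have h₁ := hN N le_rfl k (le_max_left _ _)
  rw [hs N] at h₁
  have h₂ := ht.le_gromovProduct h hX (represents_mk γ) k n
  have h₃ : R - 2 * δ ≤ min (k : ℝ) n - 2 * δ := sub_le_sub_right (le_min hk hn) _
  have := h.le_of_le (a := R - 2 * δ) (by linarith) (h₃.trans h₂)
  linarith

/-- Two vertices that are close to the same boundary point. -/
lemma le_gromovProduct_of_mem_nbhd {δ : ℝ} (h : IsHyperbolicWith X δ) (hX : X.Connected)
    {ξ : GromovBoundary X x₀} {x y : V} {R : ℝ} (hx : vertex x ∈ nbhd ξ R)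
    (hy : vertex y ∈ nbhd ξ R) : R - 4 * δ ≤ gromovProduct X x₀ x y := by
  obtain ⟨γ, rfl⟩ := Quotient.exists_rep ξ
  have h₁ := le_gromovProduct_of_vertex_mem_nbhd h hX hx (Nat.le_ceil R)
  have h₂ := le_gromovProduct_of_vertex_mem_nbhd h hX hy (Nat.le_ceil R)
  rw [gromovProduct_comm] at h₂
  have := h.le_of_le h₁ h₂
  linarith

/-- Boundary points that are approached by vertices with large Gromov products are equal. -/
lemma eq_of_forall_mem_nbhd {δ : ℝ} (h : IsHyperbolicWith X δ) (hX : X.Connected)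
    {ξ η : GromovBoundary X x₀}
    (hξη : ∀ R : ℝ, ∃ x y : V, vertex x ∈ nbhd ξ R ∧ vertex y ∈ nbhd η R ∧
      R ≤ gromovProduct X x₀ x y) : ξ = η := by
  obtain ⟨γ, rfl⟩ := Quotient.exists_rep ξ
  obtain ⟨γ', rfl⟩ := Quotient.exists_rep η
  have hδ := h.nonneg x₀
  refine Quotient.sound (asymptotic_of_gromovProduct h hX fun R => ?_)
  -- Replacing vertices by points of the rays costs `3 * δ`, and joining the three products costs `2
  -- * δ`.
  obtain ⟨x, y, hx, hy, hxy⟩ := hξη (R + 5 * δ)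
  refine ⟨⌈R + 5 * δ⌉₊, ⌈R + 5 * δ⌉₊, ?_⟩
  have h₁ := le_gromovProduct_of_vertex_mem_nbhd h hX hx (Nat.le_ceil _)
  have h₂ := le_gromovProduct_of_vertex_mem_nbhd h hX hy (Nat.le_ceil _)
  rw [gromovProduct_comm] at h₁
  have h₃ := h.le_of_le (a := R + 2 * δ) (by linarith) (hxy.trans' (by linarith))
  have h₄ := h.le_of_le (a := R + δ) (h₃.trans' (by linarith)) (h₂.trans' (by linarith))
  linarith

end Compactification

open Compactification

/-- Continuity of a Cannon-Thurston map along sequences of vertices. -/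
lemma IsCannonThurstonMap.exists_mapsTo_nbhd {W : Type v} {Y : SimpleGraph W} {y₀ : W} {f : W → V}
    {g : GromovBoundary Y y₀ → GromovBoundary X x₀} (hg : IsCannonThurstonMap f g) {δ : ℝ}
    (h : IsHyperbolicWith X δ) (hX : X.Connected) (ξ : GromovBoundary Y y₀) (R : ℝ) :
    ∃ R' : ℝ, ∀ y : W, vertex y ∈ nbhd ξ R' → vertex (f y) ∈ nbhd (g ξ) R := by
  obtain ⟨O, hO, hξ, hsub⟩ := exists_isOpen_subset_nbhd h hX (g ξ) R
  obtain ⟨R', hR'⟩ := hO.preimage hg ξ hξ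
  exact ⟨R', fun y hy => hsub (hR' hy)⟩

lemma exists_adj_between (hX : X.Connected) {x y : V} (h : x ≠ y) :
    ∃ z, X.Adj x z ∧ X.dist z y + 1 = X.dist x y := by
  obtain ⟨p, hp⟩ := hX.exists_walk_length_eq_dist x y
  cases p with
  | nil => exact absurd rfl h
  | @cons _ z _ hadj q =>
    refine ⟨z, hadj, ?_⟩
    have h₁ := SimpleGraph.dist_le q
    rw [SimpleGraph.Walk.length_cons] at hp
    have h₂ := hX.dist_triangle (u := x) (v := z) (w := y)
    have h₃ := SimpleGraph.dist_eq_one_iff_adj.2 hadj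
    omega

/-- A sequence of vertices that tends to infinity in a locally finite graph accumulates at a
boundary point. -/
lemma exists_ray_frequently_between (hX : X.Connected) (hfin : ∀ x, (X.neighborSet x).Finite)
    (x₀ : V) (x : ℕ → V) (hx : ∀ k : ℕ, ∀ᶠ n in Filter.atTop, k ≤ X.dist x₀ (x n)) :
    ∃ γ : GeodesicRay X x₀, ∀ k : ℕ, ∃ᶠ n in Filter.atTop,
      k + X.dist (γ.toFun k) (x n) = X.dist x₀ (x n) := by
  -- König's lemma: `P v` says that `v` lies between `x₀` and infinitely many `x n`. As `v` has
  -- finitely many neighbours, one of them inherits this one step further out.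
  let P : V → Prop := fun v => ∃ᶠ n in Filter.atTop, X.dist x₀ v + X.dist v (x n) = X.dist x₀ (x n)
  have hstep : ∀ v, P v → ∃ w, X.Adj v w ∧ X.dist x₀ w = X.dist x₀ v + 1 ∧ P w := by
    intro v hv
    have h₁ := hv.and_eventually (hx (X.dist x₀ v + 1))
    have h₂ : ∃ᶠ n in Filter.atTop, ∃ w ∈ X.neighborSet v, X.dist x₀ w = X.dist x₀ v + 1 ∧
        X.dist x₀ w + X.dist w (x n) = X.dist x₀ (x n) := by
      refine h₁.mono fun n ⟨hn, hn'⟩ => ?_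
      have hne : v ≠ x n := by rintro rfl; omega
      obtain ⟨w, hw, hw'⟩ := exists_adj_between hX hne
      have h₃ := hX.dist_triangle (u := x₀) (v := w) (w := x n)
      have h₄ := hX.dist_triangle (u := x₀) (v := v) (w := w)
      have h₅ := SimpleGraph.dist_eq_one_iff_adj.2 hw
      exact ⟨w, hw, by omega, by omega⟩
    by_contra hno
    push Not at hno
    refine h₂ ?_
    have : ∀ w ∈ X.neighborSet v, ∀ᶠ n in Filter.atTop, ¬ (X.dist x₀ w = X.dist x₀ v + 1 ∧
        X.dist x₀ w + X.dist w (x n) = X.dist x₀ (x n)) := by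
      intro w hw
      by_cases h₃ : X.dist x₀ w = X.dist x₀ v + 1
      · have h₄ := hno w hw h₃
        filter_upwards [Filter.not_frequently.1 h₄] with n hn hn'
        exact hn hn'.2
      · exact Filter.Eventually.of_forall fun n hn => h₃ hn.1
    filter_upwards [(Filter.eventually_all_finite (hfin v)).2 this] with n hn
    rintro ⟨w, hw, hw'⟩
    exact hn w hw hw'
  have h₀ : P x₀ := Filter.Frequently.of_forall fun n => by simp
  choose! next hnext using hstep
  let γ : ℕ → V := fun n => next^[n] x₀
  have hsucc : ∀ n, γ (n + 1) = next (γ n) := fun n => Function.iterate_succ_apply' _ _ _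
  have hγ : ∀ n, P (γ n) ∧ X.dist x₀ (γ n) = n := by
    intro n
    induction n with
    | zero => exact ⟨h₀, by simp [γ]⟩
    | succ n ih =>
      obtain ⟨h₁, h₂, h₃⟩ := hnext _ ih.1
      rw [hsucc]
      exact ⟨h₃, by rw [h₂, ih.2]⟩
  have hle : ∀ m k, X.dist (γ m) (γ (m + k)) ≤ k := by
    intro m k
    induction k with
    | zero => simp
    | succ k ih =>
      have h₁ := SimpleGraph.dist_eq_one_iff_adj.2 (hnext _ (hγ (m + k)).1).1
      rw [← hsucc] at h₁
      have := hX.dist_triangle (u := γ m) (v := γ (m + k)) (w := γ (m + k + 1))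
      rw [← add_assoc]
      omega
  refine ⟨⟨γ, rfl, fun m k => ?_⟩, fun k => ?_⟩
  · rw [← (hX _ _).coe_dist_eq_edist]
    have h₁ := hX.dist_triangle (u := x₀) (v := γ m) (w := γ (m + k))
    rw [(hγ m).2, (hγ _).2] at h₁
    have := hle m k
    exact_mod_cast (show X.dist (γ m) (γ (m + k)) = k by omega)
  · have := (hγ k).1
    simp only [P, (hγ k).2] at this
    exact this

/-- Vertices `x` such that some geodesic from `x₀` to `x` agrees with the ray `γ` up to time `k`
are close to the end of `γ`. -/
lemma GeodesicRay.vertex_mem_nbhd (hX : X.Connected) (γ : GeodesicRay X x₀) {k : ℕ} {x : V}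
    (hx : k + X.dist (γ.toFun k) x = X.dist x₀ x) :
    vertex x ∈ nbhd (Quotient.mk (raySetoid X x₀) γ) k := by
  refine vertex_mem_nbhd_mk (N := k) fun n hn => ?_
  have h₁ : (k : ℝ) + X.dist (γ.toFun k) x = X.dist x₀ x := by exact_mod_cast hx
  have h₂ := dist_triangle_real hX x (γ.toFun k) (γ.toFun n)
  rw [γ.dist_eq hn, Nat.cast_sub hn, X.dist_comm (u := x) (v := γ.toFun k)] at h₂
  rw [gromovProduct, γ.dist_base]
  linarith

/-- A sequence of vertices that tends to infinity in a locally finite graph has a subsequence that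
converges to a boundary point. -/
lemma exists_subseq_mem_nbhd (hX : X.Connected) (hfin : ∀ x, (X.neighborSet x).Finite)
    (x₀ : V) (x : ℕ → V) (hx : ∀ k : ℕ, ∀ᶠ n in Filter.atTop, k ≤ X.dist x₀ (x n)) :
    ∃ (ξ : GromovBoundary X x₀) (φ : ℕ → ℕ), StrictMono φ ∧
      ∀ R : ℝ, ∀ᶠ n in Filter.atTop, vertex (x (φ n)) ∈ nbhd ξ R := by
  obtain ⟨γ, hγ⟩ := exists_ray_frequently_between hX hfin x₀ x hx
  obtain ⟨φ, hφ, hφ'⟩ := Filter.extraction_forall_of_frequently hγ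
  refine ⟨Quotient.mk _ γ, φ, hφ, fun R => ?_⟩
  filter_upwards [Filter.eventually_ge_atTop ⌈R⌉₊] with n hn
  exact nbhd_antitone _ (Nat.ceil_le.1 hn) (γ.vertex_mem_nbhd hX (hφ' n))

/-- If a Cannon-Thurston map is injective, then large Gromov products in the target come from large
Gromov products in the source. -/
lemma IsCannonThurstonMap.exists_gromovProduct_lt {W : Type v} {Y : SimpleGraph W} {y₀ : W}
    {f : W → V} {g : GromovBoundary Y y₀ → GromovBoundary X x₀} (hg : IsCannonThurstonMap f g)
    (hinj : Function.Injective g) {δ δ' : ℝ} (h : IsHyperbolicWith X δ) (hX : X.Connected)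
    (h' : IsHyperbolicWith Y δ') (hY : Y.Connected) (hfin : ∀ y, (Y.neighborSet y).Finite)
    (hf₀ : f y₀ = x₀) (hf : ∀ y z, X.dist (f y) (f z) ≤ Y.dist y z) (N : ℝ) :
    ∃ M : ℝ, ∀ y z : W, gromovProduct Y y₀ y z < N → gromovProduct X x₀ (f y) (f z) < M := by
  -- The counterexamples have products at least `n` in `X`; since `f` is Lipschitz, `y n` and `z n`
  -- tend to infinity in `Y`.
  by_contra hno
  push Not at hno
  choose y z hN hM using fun n : ℕ => hno n
  have htend : ∀ (k n : ℕ), k ≤ n → k ≤ Y.dist y₀ (y n) ∧ k ≤ Y.dist y₀ (z n) := by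
    intro k n hkn
    have h₁ := (hM n).trans (gromovProduct_le_dist_left hX _ _ _)
    have h₂ := (hM n).trans (gromovProduct_le_dist_right hX _ _ _)
    rw [← hf₀] at h₁ h₂
    have h₃ := hf y₀ (y n)
    have h₄ := hf y₀ (z n)
    norm_cast at h₁ h₂
    omega
  obtain ⟨ξ, φ, hφ, hξ⟩ := exists_subseq_mem_nbhd hY hfin y₀ y fun k =>
    (Filter.eventually_ge_atTop k).mono fun n hn => (htend k n hn).1
  -- The second subsequence is extracted from the first, so both sequences converge along `φ ∘ ψ`.
  obtain ⟨η, ψ, hψ, hη⟩ := exists_subseq_mem_nbhd hY hfin y₀ (z ∘ φ) fun k =>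
    (Filter.eventually_ge_atTop k).mono fun n hn =>
      (htend k (φ n) (hn.trans (hφ.id_le n))).2
  replace hξ : ∀ R : ℝ, ∀ᶠ n in Filter.atTop, vertex (y (φ (ψ n))) ∈ nbhd ξ R :=
    fun R => hψ.tendsto_atTop.eventually (hξ R)
  have heq : g ξ = g η := by
    refine eq_of_forall_mem_nbhd h hX fun R => ?_
    obtain ⟨R₁, h₁⟩ := hg.exists_mapsTo_nbhd h hX ξ R
    obtain ⟨R₂, h₂⟩ := hg.exists_mapsTo_nbhd h hX η R
    obtain ⟨n, h₃, h₄, h₅⟩ := ((hξ R₁).and ((hη R₂).and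
      (Filter.eventually_ge_atTop ⌈R⌉₊))).exists
    refine ⟨_, _, h₁ _ h₃, h₂ _ h₄, le_trans ?_ (hM (φ (ψ n)))⟩
    exact (Nat.ceil_le.1 h₅).trans
      (by exact_mod_cast (hψ.id_le n).trans (hφ.id_le _))
  obtain rfl := hinj heq
  obtain ⟨n, h₁, h₂⟩ := ((hξ (N + 4 * δ')).and (hη (N + 4 * δ'))).exists
  have h₃ := le_gromovProduct_of_mem_nbhd h' hY h₁ h₂
  have h₄ := hN (φ (ψ n))
  simp only [Function.comp_apply] at h₃
  linarith

/-- If large Gromov products in the target come from large Gromov products in the source, then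
Cannon-Thurston maps are injective. -/
lemma IsCannonThurstonMap.injective_of_gromovProduct_le {W : Type v} {Y : SimpleGraph W} {y₀ : W}
    {f : W → V} {g : GromovBoundary Y y₀ → GromovBoundary X x₀} (hg : IsCannonThurstonMap f g)
    {δ δ' K : ℝ} (h : IsHyperbolicWith X δ) (hX : X.Connected)
    (h' : IsHyperbolicWith Y δ') (hY : Y.Connected)
    (hK : ∀ y z : W, gromovProduct X x₀ (f y) (f z) ≤ gromovProduct Y y₀ y z + K) :
    Function.Injective g := by
  intro ξ η heq
  refine eq_of_forall_mem_nbhd h' hY fun R => ?_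
  -- Two vertices near one boundary point lose `4 * δ`; `K` pays for the return to `Y`.
  obtain ⟨R₁, h₁⟩ := hg.exists_mapsTo_nbhd h hX ξ (R + K + 4 * δ)
  obtain ⟨R₂, h₂⟩ := hg.exists_mapsTo_nbhd h hX η (R + K + 4 * δ)
  have hex : ∀ (ξ : GromovBoundary Y y₀) (R : ℝ), ∃ y, vertex y ∈ nbhd ξ R := by
    intro ξ R
    obtain ⟨γ, rfl⟩ := Quotient.exists_rep ξ
    refine ⟨γ.toFun ⌈R⌉₊, nbhd_antitone _ (Nat.le_ceil R) (γ.vertex_mem_nbhd hY ?_)⟩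
    simp [γ.dist_base]
  obtain ⟨y, hy⟩ := hex ξ (max R R₁)
  obtain ⟨z, hz⟩ := hex η (max R R₂)
  refine ⟨y, z, nbhd_antitone _ (le_max_left _ _) hy, nbhd_antitone _ (le_max_left _ _) hz, ?_⟩
  have h₃ := h₁ y (nbhd_antitone _ (le_max_right _ _) hy)
  have h₄ := h₂ z (nbhd_antitone _ (le_max_right _ _) hz)
  rw [heq] at h₃
  have h₅ := le_gromovProduct_of_mem_nbhd h hX h₃ h₄
  have h₆ := hK y z
  linarith

end Boundary

end GraphGeometry

/-! ### Automorphisms, balls and Lipschitz maps of graphs -/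

namespace SimpleGraph

variable {V : Type u} {X : SimpleGraph V}

lemma dist_smul {G : Type v} [Group G] [MulAction G V]
    (h : ∀ (g : G) (x y : V), X.Adj (g • x) (g • y) ↔ X.Adj x y) (hX : X.Connected)
    (g : G) (x y : V) : X.dist (g • x) (g • y) = X.dist x y := by
  have key : ∀ (g : G) (x y : V), X.dist (g • x) (g • y) ≤ X.dist x y := by
    intro g x y
    obtain ⟨p, hp⟩ := hX.exists_walk_length_eq_dist x y
    let φ : X →g X := ⟨fun v => g • v, fun {a b} hab => (h g a b).2 hab⟩
    rw [← hp, ← SimpleGraph.Walk.length_map φ p]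
    exact SimpleGraph.dist_le (p.map φ)
  refine le_antisymm (key g x y) ?_
  simpa using key g⁻¹ (g • x) (g • y)

lemma finite_dist_le (hX : X.Connected) (hfin : ∀ x, (X.neighborSet x).Finite) (x : V) (n : ℕ) :
    {y | X.dist x y ≤ n}.Finite := by
  induction n with
  | zero =>
    refine (Set.finite_singleton x).subset fun y hy => ?_
    exact ((hX.dist_eq_zero_iff).1 (Nat.le_zero.1 hy)).symm
  | succ n ih =>
    refine (ih.union (ih.biUnion fun y _ => hfin y)).subset fun y hy => ?_
    by_cases hxy : y = x
    · left
      simp [hxy]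
    · obtain ⟨z, hz, hz'⟩ := GraphGeometry.exists_adj_between hX hxy
      right
      simp only [Set.mem_iUnion, Set.mem_ofPred_eq] at hy ⊢
      refine ⟨z, ?_, hz.symm⟩
      rw [X.dist_comm] at hy
      rw [X.dist_comm]
      omega

lemma dist_le_of_adj_imp {W : Type v} {Y : SimpleGraph W} (hX : X.Connected) (hY : Y.Connected)
    {f : V → W} (hf : ∀ x y, X.Adj x y → Y.dist (f x) (f y) ≤ 1) (x y : V) :
    Y.dist (f x) (f y) ≤ X.dist x y := by
  obtain ⟨p, hp⟩ := hX.exists_walk_length_eq_dist x y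
  rw [← hp]
  clear hp
  induction p with
  | nil => simp
  | @cons a b c hadj q ih =>
    have h₁ := hf a b hadj
    have h₂ := hY.dist_triangle (u := f a) (v := f b) (w := f c)
    rw [SimpleGraph.Walk.length_cons]
    omega

end SimpleGraph

namespace TDLC

open GraphGeometry
open scoped Pointwise

/-! ### Cayley-Abels graphs of one group are quasi-isometric -/

section CayleyAbels

variable {G : Type u} [Group G] {V : Type v} [MulAction G V] {X : SimpleGraph V}
  {W : Type w} [MulAction G W] {Y : SimpleGraph W}

lemma setOf_smul_eq (g : G) (x : V) :
    {k : G | k • x = g • x} = g • (MulAction.stabilizer G x : Set G) := by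
  ext k
  rw [Set.mem_smul_set_iff_inv_smul_mem, SetLike.mem_coe, MulAction.mem_stabilizer_iff,
    smul_eq_mul, mul_smul, inv_smul_eq_iff]
  rfl

variable [TopologicalSpace G]

lemma IsCayleyAbelsGraph.dist_smul (hX : IsCayleyAbelsGraph G X) (g : G) (x y : V) :
    X.dist (g • x) (g • y) = X.dist x y :=
  SimpleGraph.dist_smul hX.adj_smul_iff hX.connected g x y

lemma IsCayleyAbelsGraph.exists_smul_eq (hX : IsCayleyAbelsGraph G X) (x y : V) :
    ∃ g : G, g • x = y :=
  hX.transitive.exists_smul_eq x y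

variable [IsTopologicalGroup G]

lemma IsCayleyAbelsGraph.isOpen_setOf_smul_eq (hX : IsCayleyAbelsGraph G X) (x y : V) :
    IsOpen {k : G | k • x = y} := by
  obtain ⟨g, rfl⟩ := hX.exists_smul_eq x y
  rw [setOf_smul_eq]
  exact (hX.isOpen_stabilizer x).smul g

lemma IsCayleyAbelsGraph.isCompact_setOf_smul_eq (hX : IsCayleyAbelsGraph G X) (x y : V) :
    IsCompact {k : G | k • x = y} := by
  obtain ⟨g, rfl⟩ := hX.exists_smul_eq x y
  rw [setOf_smul_eq]
  exact (hX.isCompact_stabilizer x).smul g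

/-- Balls are finite, so this set is a finite union of cosets of a compact stabilizer. -/
lemma IsCayleyAbelsGraph.isCompact_setOf_dist_le (hX : IsCayleyAbelsGraph G X) (x : V) (n : ℕ) :
    IsCompact {g : G | X.dist x (g • x) ≤ n} := by
  have := (SimpleGraph.finite_dist_le hX.connected hX.locallyFinite x n).isCompact_biUnion
    fun y _ => hX.isCompact_setOf_smul_eq x y
  convert this using 1
  ext g
  simp

lemma IsCayleyAbelsGraph.exists_dist_le (hX : IsCayleyAbelsGraph G X) (x : V) {K : Set G}
    (hK : IsCompact K) : ∃ M : ℕ, ∀ g ∈ K, X.dist x (g • x) ≤ M := by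
  obtain ⟨t, ht⟩ := hK.elim_finite_subcover (fun y : V => {k : G | k • x = y})
    (fun y => hX.isOpen_setOf_smul_eq x y) (fun g _ => by simp)
  refine ⟨t.sup fun y => X.dist x y, fun g hg => ?_⟩
  have := ht hg
  simp only [Set.mem_iUnion, Set.mem_ofPred_eq, exists_prop, exists_eq_right'] at this
  exact Finset.le_sup (f := fun y => X.dist x y) this

/-- The Milnor-Schwarz argument: the elements moving `y` by at most 1 form a compact set, so they
move `x` by at most `M`, and this is summed along a geodesic of `Y`. The `+ 1` is needed because `g
• y = h • y` does not force `g • x = h • x`. -/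
lemma IsCayleyAbelsGraph.exists_dist_smul_le (hX : IsCayleyAbelsGraph G X)
    (hY : IsCayleyAbelsGraph G Y) (x : V) (y : W) :
    ∃ M : ℕ, ∀ g h : G, X.dist (g • x) (h • x) ≤ M * (Y.dist (g • y) (h • y) + 1) := by
  obtain ⟨M, hM⟩ := hX.exists_dist_le x (hY.isCompact_setOf_dist_le y 1)
  have key : ∀ g h : G, Y.dist (g • y) (h • y) ≤ 1 → X.dist (g • x) (h • x) ≤ M := by
    intro g h hgh
    have h₁ := hM (g⁻¹ * h)
    rw [Set.mem_ofPred_eq, mul_smul, mul_smul] at h₁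
    rw [← hX.dist_smul g⁻¹, inv_smul_smul]
    apply h₁
    rw [← hY.dist_smul g, smul_inv_smul]
    exact hgh
  refine ⟨M, fun g h => ?_⟩
  induction hn : Y.dist (g • y) (h • y) generalizing g with
  | zero => simpa using key g h (by omega)
  | succ n ih =>
    have hne : g • y ≠ h • y := by
      intro heq
      rw [heq] at hn
      simp at hn
    obtain ⟨z, hz, hz'⟩ := exists_adj_between hY.connected hne
    obtain ⟨g', rfl⟩ := hY.exists_smul_eq y z
    have h₁ := key g g' (SimpleGraph.dist_eq_one_iff_adj.2 hz).le
    have h₂ := ih g' (by omega)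
    have h₃ := hX.connected.dist_triangle (u := g • x) (v := g' • x) (w := h • x)
    rw [mul_add_one]
    omega

/-- Two Cayley-Abels graphs are quasi-isometric. -/
lemma IsCayleyAbelsGraph.exists_isQIEmbedding (hX : IsCayleyAbelsGraph G X)
    (hY : IsCayleyAbelsGraph G Y) (x : V) (y : W) :
    ∃ (L : ℝ) (f : V → W), IsQIEmbedding X Y L f ∧
      ∀ g : G, (Y.dist (f (g • x)) (g • y) : ℝ) ≤ L := by
  choose s hs using fun z => hX.exists_smul_eq x z
  obtain ⟨M, hM⟩ := hX.exists_dist_smul_le hY x y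
  obtain ⟨M', hM'⟩ := hY.exists_dist_smul_le hX y x
  -- The map depends on the choice of `s z`, which is determined only up to the stabilizer of `x`;
  -- the additive constant absorbs this.
  refine ⟨max M M', fun z => s z • y, ⟨fun a b => ?_, fun a b => ?_⟩, fun g => ?_⟩
  · have h₁ := hM' (s a) (s b)
    rw [hs, hs] at h₁
    have h₂ : (Y.dist (s a • y) (s b • y) : ℝ) ≤ M' * (X.dist a b + 1) := by exact_mod_cast h₁
    refine h₂.trans ?_
    rw [← mul_add_one]
    gcongr
    exact le_max_right _ _
  · have h₁ := hM (s a) (s b)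
    rw [hs, hs] at h₁
    have h₂ : (X.dist a b : ℝ) ≤ M * (Y.dist (s a • y) (s b • y) + 1) := by exact_mod_cast h₁
    refine h₂.trans ?_
    rw [← mul_add_one]
    gcongr
    exact le_max_left _ _
  · have h₁ := hM' (s (g • x)) g
    rw [hs, SimpleGraph.dist_self, zero_add, mul_one] at h₁
    refine le_trans ?_ (le_max_right _ _)
    exact_mod_cast h₁

lemma IsCayleyAbelsGraph.isGromovHyperbolic_of (hX : IsCayleyAbelsGraph G X)
    (hY : IsCayleyAbelsGraph G Y) (h : IsGromovHyperbolic Y) : IsGromovHyperbolic X := by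
  obtain ⟨x⟩ := hX.connected.nonempty
  obtain ⟨y⟩ := hY.connected.nonempty
  obtain ⟨L, f, hf, -⟩ := hX.exists_isQIEmbedding hY x y
  exact hf.isGromovHyperbolic hX.connected hY.connected h

/-- Every Cayley-Abels graph of a hyperbolic group is hyperbolic. -/
lemma IsCayleyAbelsGraph.isGromovHyperbolic (hX : IsCayleyAbelsGraph G X)
    (hG : IsHyperbolicGroup G) : IsGromovHyperbolic X := by
  obtain ⟨-, V', _, X', hX', h⟩ := hG
  exact hX.isGromovHyperbolic_of hX' h

/-- Quasiconvexity of a subgroup does not depend on the Cayley-Abels graph. -/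
lemma IsCayleyAbelsGraph.isQuasiconvex_orbit (hX : IsCayleyAbelsGraph G X)
    (hY : IsCayleyAbelsGraph G Y) (hG : IsHyperbolicGroup G) (H : Subgroup G) (x : V) (y : W)
    (h : IsQuasiconvex Y (MulAction.orbit H y)) : IsQuasiconvex X (MulAction.orbit H x) := by
  obtain ⟨L, f, hf, hfL⟩ := hX.exists_isQIEmbedding hY x y
  refine hf.isQuasiconvex hX.connected hY.connected (hY.isGromovHyperbolic hG) (M := L) ?_ ?_ h
  · rintro _ ⟨g, rfl⟩
    exact ⟨g • y, ⟨g, rfl⟩, hfL g⟩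
  · rintro _ ⟨g, rfl⟩
    exact ⟨g • x, ⟨g, rfl⟩, hfL g⟩

end CayleyAbels

/-! ### The coset graph is a Cayley-Abels graph -/

section CosetGraph

variable {G : Type u} [Group G]

lemma cosetGraph_adj_smul_iff (U : Subgroup G) (A : Set G) (g : G) (x y : G ⧸ U) :
    (cosetGraph U A).Adj (g • x) (g • y) ↔ (cosetGraph U A).Adj x y := by
  have key : ∀ (g : G) (x y : G ⧸ U), (cosetGraph U A).Adj x y →
      (cosetGraph U A).Adj (g • x) (g • y) := by
    intro g x y h
    rw [cosetGraph, SimpleGraph.fromRel_adj] at h ⊢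
    refine ⟨fun heq => h.1 (smul_left_cancel g heq), h.2.imp ?_ ?_⟩ <;>
    · rintro ⟨k, a, ha, rfl, rfl⟩
      refine ⟨g * k, a, ha, rfl, ?_⟩
      rw [mul_assoc]
      rfl
  refine ⟨fun h => ?_, key g x y⟩
  simpa using key g⁻¹ _ _ h

lemma cosetGraph_adj_or_eq (U : Subgroup G) {A : Set G} (g : G) {a : G} (ha : a ∈ A) :
    (cosetGraph U A).Adj (g : G ⧸ U) ((g * a : G) : G ⧸ U) ∨
      (g : G ⧸ U) = ((g * a : G) : G ⧸ U) := by
  by_cases h : (g : G ⧸ U) = ((g * a : G) : G ⧸ U)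
  · exact Or.inr h
  · left
    rw [cosetGraph, SimpleGraph.fromRel_adj]
    exact ⟨h, Or.inl ⟨g, a, ha, rfl, rfl⟩⟩

lemma stabilizer_mk (U : Subgroup G) (g : G) :
    (MulAction.stabilizer G (g : G ⧸ U) : Set G) = (fun k => g * k * g⁻¹) '' (U : Set G) := by
  ext k
  rw [SetLike.mem_coe, MulAction.mem_stabilizer_iff, Set.mem_image]
  constructor
  · intro h
    refine ⟨g⁻¹ * k * g, ?_, by group⟩
    have h' : ((k * g : G) : G ⧸ U) = g := h
    rw [eq_comm, QuotientGroup.eq] at h'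
    rwa [mul_assoc]
  · rintro ⟨u, hu, rfl⟩
    change ((g * u * g⁻¹ * g : G) : G ⧸ U) = g
    rw [eq_comm, QuotientGroup.eq]
    simpa [mul_assoc] using hu

variable [TopologicalSpace G] {U : Subgroup G} {A : Set G}

lemma IsCayleyAbelsData.connected (h : IsCayleyAbelsData U A) : (cosetGraph U A).Connected := by
  have key : ∀ g ∈ Subgroup.closure A, ∀ k : G,
      (cosetGraph U A).Reachable (k : G ⧸ U) ((k * g : G) : G ⧸ U) := by
    intro g hg
    induction hg using Subgroup.closure_induction with
    | mem a ha =>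
      intro k
      rcases cosetGraph_adj_or_eq U k ha with h₁ | h₁
      · exact h₁.reachable
      · rw [← h₁]
    | one => simp
    | mul a b _ _ iha ihb =>
      intro k
      rw [← mul_assoc]
      exact (iha k).trans (ihb _)
    | inv a _ ih =>
      intro k
      have := ih (k * a⁻¹)
      rw [inv_mul_cancel_right] at this
      exact this.symm
  have hbase : ∀ x : G ⧸ U, (cosetGraph U A).Reachable ((1 : G) : G ⧸ U) x := by
    intro x
    obtain ⟨g, rfl⟩ := QuotientGroup.mk_surjective x
    have hg : g ∈ (Subgroup.closure A : Set G) * (U : Set G) := by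
      rw [h.generates]
      trivial
    obtain ⟨a, ha, k, hk, rfl⟩ := hg
    have h₁ := key a ha 1
    rw [one_mul] at h₁
    rwa [QuotientGroup.mk_mul_of_mem a hk]
  exact { preconnected := fun x y => (hbase x).symm.trans (hbase y), nonempty := ⟨((1 : G) : G ⧸ U)⟩ }

/-- Another representative of `gU` differs by an element of `U`, which `UAU = AU` moves past `A`; so
all neighbours are among the `gbU` with `b ∈ A`. Symmetry of `A` handles reversed edges. -/
lemma IsCayleyAbelsData.neighborSet_finite (h : IsCayleyAbelsData U A) (x : G ⧸ U) :
    ((cosetGraph U A).neighborSet x).Finite := by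
  obtain ⟨g, rfl⟩ := QuotientGroup.mk_surjective x
  refine (h.finite.image fun a => ((g * a : G) : G ⧸ U)).subset fun y hy => ?_
  have key : ∀ a ∈ A, ∀ k : G, (g : G ⧸ U) = k →
      ((k * a : G) : G ⧸ U) ∈ (fun a => ((g * a : G) : G ⧸ U)) '' A := by
    intro a ha k hk
    rw [QuotientGroup.eq] at hk
    have hmem : g⁻¹ * k * a ∈ A * (U : Set G) := by
      rw [← h.mul_mul_eq]
      exact ⟨_, Set.mul_mem_mul hk ha, 1, U.one_mem, mul_one _⟩
    obtain ⟨b, hb, u, hu, hbu⟩ := hmem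
    refine ⟨b, hb, ?_⟩
    simp only at hbu ⊢
    rw [QuotientGroup.eq]
    have : (g * b)⁻¹ * (k * a) = u := by
      rw [mul_inv_rev, mul_assoc, ← mul_assoc g⁻¹ k a, ← hbu]
      group
    rwa [this]
  rw [SimpleGraph.mem_neighborSet, cosetGraph, SimpleGraph.fromRel_adj] at hy
  rcases hy.2 with ⟨k, a, ha, hk, rfl⟩ | ⟨k, a, ha, rfl, hk⟩
  · exact key a ha k hk
  · have ha' : a⁻¹ ∈ A := by
      rw [← h.symmetric]
      simpa using ha
    simpa using key a⁻¹ ha' (k * a) hk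

lemma IsCayleyAbelsData.isCayleyAbelsGraph [IsTopologicalGroup G] (h : IsCayleyAbelsData U A) :
    IsCayleyAbelsGraph G (cosetGraph U A) where
  connected := h.connected
  locallyFinite := h.neighborSet_finite
  adj_smul_iff := cosetGraph_adj_smul_iff U A
  transitive := inferInstance
  isCompact_stabilizer x := by
    obtain ⟨g, rfl⟩ := QuotientGroup.mk_surjective x
    rw [stabilizer_mk]
    exact h.isCompact.image (by fun_prop)
  isOpen_stabilizer x := by
    obtain ⟨g, rfl⟩ := QuotientGroup.mk_surjective x
    rw [stabilizer_mk]
    have := ((Homeomorph.mulLeft g).trans (Homeomorph.mulRight g⁻¹)).isOpenMap _ h.isOpen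
    exact this

end CosetGraph

/-! ### The inclusion of the coset graph of the subgroup -/

section CosetMap

variable {G : Type u} [Group G] {H U : Subgroup G}

lemma cosetMap_mk (h : H) :
    cosetMap H U (h : H ⧸ U.subgroupOf H) = ((h : G) : G ⧸ U) := rfl

lemma cosetMap_smul (h : H) (x : H ⧸ U.subgroupOf H) :
    cosetMap H U (h • x) = h • cosetMap H U x := by
  obtain ⟨k, rfl⟩ := QuotientGroup.mk_surjective x
  rfl

lemma range_cosetMap :
    Set.range (cosetMap H U) = MulAction.orbit H ((1 : G) : G ⧸ U) := by
  have key : ∀ h : H, h • ((1 : G) : G ⧸ U) = cosetMap H U h := by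
    intro h
    change (((h : G) * 1 : G) : G ⧸ U) = ((h : G) : G ⧸ U)
    rw [mul_one]
  ext x
  constructor
  · rintro ⟨y, rfl⟩
    obtain ⟨h, rfl⟩ := QuotientGroup.mk_surjective y
    exact ⟨h, key h⟩
  · rintro ⟨h, rfl⟩
    exact ⟨h, (key h).symm⟩

variable [TopologicalSpace G] {A_G : Set G} {A_H : Set H}

lemma dist_cosetMap_le (hG : IsCayleyAbelsData U A_G) (hH : IsCayleyAbelsData (U.subgroupOf H) A_H)
    (hA : ∀ a ∈ A_H, (a : G) ∈ A_G) (x y : H ⧸ U.subgroupOf H) :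
    (cosetGraph U A_G).dist (cosetMap H U x) (cosetMap H U y) ≤
      (cosetGraph (U.subgroupOf H) A_H).dist x y := by
  refine SimpleGraph.dist_le_of_adj_imp hH.connected hG.connected (fun x y hxy => ?_) x y
  have key : ∀ (k a : H), a ∈ A_H →
      (cosetGraph U A_G).dist (cosetMap H U k) (cosetMap H U ((k * a : H) : H ⧸ _)) ≤ 1 := by
    intro k a ha
    rcases cosetGraph_adj_or_eq U (k : G) (hA a ha) with h | h
    · exact (SimpleGraph.dist_eq_one_iff_adj.2 h).le
    · rw [cosetMap_mk, cosetMap_mk, Subgroup.coe_mul, ← h, SimpleGraph.dist_self]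
      exact zero_le_one
  rw [cosetGraph, SimpleGraph.fromRel_adj] at hxy
  rcases hxy.2 with ⟨k, a, ha, rfl, rfl⟩ | ⟨k, a, ha, rfl, rfl⟩
  · exact key k a ha
  · rw [SimpleGraph.dist_comm]
    exact key k a ha

/-- The inclusion of the Cayley-Abels graph of an open subgroup is metrically proper. -/
lemma exists_dist_le_of_dist_cosetMap_le [IsTopologicalGroup G] (hHopen : IsOpen (H : Set G))
    (hG : IsCayleyAbelsData U A_G) (hH : IsCayleyAbelsData (U.subgroupOf H) A_H) (n : ℕ) :
    ∃ C : ℕ, ∀ x y : H ⧸ U.subgroupOf H,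
      (cosetGraph U A_G).dist (cosetMap H U x) (cosetMap H U y) ≤ n →
        (cosetGraph (U.subgroupOf H) A_H).dist x y ≤ C := by
  -- An open subgroup is closed, so it meets a compact subset of `G` in a compact subset of `H`.
  have hK : IsCompact {h : H | (cosetGraph U A_G).dist ((1 : G) : G ⧸ U)
      ((h : G) • ((1 : G) : G ⧸ U)) ≤ n} :=
    (Subgroup.isClosed_of_isOpen H hHopen).isClosedEmbedding_subtypeVal.isCompact_preimage
      (hG.isCayleyAbelsGraph.isCompact_setOf_dist_le ((1 : G) : G ⧸ U) n)
  obtain ⟨C, hC⟩ := hH.isCayleyAbelsGraph.exists_dist_le ((1 : H) : H ⧸ U.subgroupOf H) hK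
  refine ⟨C, fun x y hxy => ?_⟩
  obtain ⟨h, rfl⟩ := hH.isCayleyAbelsGraph.exists_smul_eq ((1 : H) : H ⧸ U.subgroupOf H) x
  obtain ⟨k, rfl⟩ := hH.isCayleyAbelsGraph.exists_smul_eq ((1 : H) : H ⧸ U.subgroupOf H) y
  have h₁ := hC (h⁻¹ * k)
  rw [mul_smul] at h₁
  rw [← hH.isCayleyAbelsGraph.dist_smul h⁻¹, inv_smul_smul]
  apply h₁
  rw [Set.mem_ofPred_eq, ← hG.isCayleyAbelsGraph.dist_smul (h : G)]
  rw [cosetMap_smul, cosetMap_smul] at hxy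
  rw [Subgroup.coe_mul, Subgroup.coe_inv, mul_smul, smul_inv_smul]
  exact hxy

end CosetMap

end TDLC

namespace GraphGeometry

/-! ### Quasiconvex images and Gromov products -/

section Embedding

variable {V : Type u} {W : Type v} {X : SimpleGraph V} {Y : SimpleGraph W} {f : W → V}

/-- If a Lipschitz map does not increase small Gromov products much, then its image is
quasiconvex. -/
lemma isQuasiconvex_range {δ M : ℝ} (h : IsHyperbolicWith X δ) (hX : X.Connected)
    (hY : Y.Connected) (hf : ∀ y z, X.dist (f y) (f z) ≤ Y.dist y z)
    (hM : ∀ p y z, gromovProduct Y p y z < 1 → gromovProduct X (f p) (f y) (f z) < M) :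
    IsQuasiconvex X (Set.range f) := by
  refine ⟨⌈2 * M + 1 + 2 * δ⌉₊, ?_⟩
  rintro _ ⟨a, rfl⟩ _ ⟨b, rfl⟩ p hp z hz
  have hδ := h.nonneg z
  obtain ⟨k, rfl, hk⟩ := SimpleGraph.Walk.mem_support_iff_exists_getVert.1 hz
  have hbet := (isGeodesic_getVert hX p hp).between hk
  rw [p.getVert_zero, p.getVert_length] at hbet
  set z := p.getVert k
  obtain ⟨c, h₀, hm, hc⟩ := exists_isGeodesic hY a b
  set m := Y.dist a b
  have hprod : ∀ i ≤ m, gromovProduct X (f (c i)) (f a) (f b) < M := by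
    intro i hi
    apply hM
    have := gromovProduct_eq_zero_of_between (hc.between hi)
    rw [h₀, hm] at this
    rw [this]
    exact one_pos
  have hM₀ : 0 < M := (gromovProduct_nonneg hX _ _ _).trans_lt (hprod 0 (Nat.zero_le _))
  -- A discrete intermediate value argument: along the image of `c` the distance to `f a` grows by
  -- at most 1 per step, from 0 to at least that of `z`.
  have key : ∃ i ≤ m, X.dist (f a) (f (c i)) ≤ X.dist (f a) z ∧
      X.dist (f a) z ≤ X.dist (f a) (f (c i)) + 1 := by
    by_contra hno
    push Not at hno
    have hall : ∀ i ≤ m, X.dist (f a) (f (c i)) ≤ X.dist (f a) z := by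
      intro i
      induction i with
      | zero => intro _; simp [h₀]
      | succ i ih =>
        intro hi
        have h₁ := hno i (by omega) (ih (by omega))
        have h₂ := hX.dist_triangle (u := f a) (v := f (c i)) (w := f (c (i + 1)))
        have h₃ := hf (c i) (c (i + 1))
        have h₄ := hc i (i + 1) i.le_succ hi
        omega
    have h₁ := hno m le_rfl (hall m le_rfl)
    rw [hm] at h₁
    have h₂ : X.dist (f a) z + X.dist z (f b) = X.dist (f a) (f b) := by exact_mod_cast hbet
    omega
  obtain ⟨i, hi, hle, hge⟩ := key
  refine ⟨f (c i), ⟨c i, rfl⟩, ?_⟩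
  have hle' : (X.dist (f a) (f (c i)) : ℝ) ≤ X.dist (f a) z := by exact_mod_cast hle
  have hge' : (X.dist (f a) z : ℝ) ≤ X.dist (f a) (f (c i)) + 1 := by exact_mod_cast hge
  have h₁ := hprod i hi
  -- Both `z` and `f (c i)` are coarsely between `f a` and `f b`, at the same distance from `f a` up
  -- to 1. The four-point inequality then makes them close.
  have h₂ := h.four_point z (f (c i)) (f a) (f b)
  have h₃ : (X.dist z (f (c i)) : ℝ) ≤ 2 * M + 1 + 2 * δ := by
    rw [gromovProduct] at h₁
    rw [X.dist_comm (u := f (c i)) (v := f a)] at h₁ h₂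
    rw [X.dist_comm (u := z) (v := f a)] at h₂
    rcases max_cases ((X.dist (f a) z : ℝ) + X.dist (f (c i)) (f b))
      (X.dist z (f b) + X.dist (f a) (f (c i))) with ⟨h₄, -⟩ | ⟨h₄, -⟩ <;>
    · rw [h₄] at h₂
      linarith
  exact_mod_cast h₃.trans (Nat.le_ceil _)

/-- A Lipschitz and metrically proper map with quasiconvex image is a quasi-isometric
embedding. -/
lemma IsQuasiconvex.exists_isQIEmbedding (hX : X.Connected) (hY : Y.Connected)
    (hf : ∀ y z, X.dist (f y) (f z) ≤ Y.dist y z)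
    (hprop : ∀ n : ℕ, ∃ C : ℕ, ∀ y z, X.dist (f y) (f z) ≤ n → Y.dist y z ≤ C)
    (hq : IsQuasiconvex X (Set.range f)) : ∃ L : ℝ, IsQIEmbedding Y X L f := by
  obtain ⟨D, hD⟩ := hq
  -- Shadows in the image of consecutive geodesic vertices are at most `D + 1 + D` apart.
  obtain ⟨C, hC⟩ := hprop (2 * D + 1)
  have key : ∀ y z, Y.dist y z ≤ C * X.dist (f y) (f z) + 2 * C := by
    intro y z
    obtain ⟨p, hp⟩ := hX.exists_walk_length_eq_dist (f y) (f z)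
    have hnear : ∀ i, ∃ q, X.dist (p.getVert i) (f q) ≤ D := by
      intro i
      obtain ⟨_, ⟨q, rfl⟩, hq⟩ := hD _ ⟨y, rfl⟩ _ ⟨z, rfl⟩ p hp _ (p.getVert_mem_support i)
      exact ⟨q, hq⟩
    choose q hq using hnear
    have hgeo := isGeodesic_getVert hX p hp
    have hind : ∀ i ≤ p.length, Y.dist y (q i) ≤ C * i + C := by
      intro i
      induction i with
      | zero =>
        intro _
        have h₁ := hq 0
        rw [p.getVert_zero] at h₁
        have := hC y (q 0) (by omega)
        omega
      | succ i ih =>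
        intro hi
        have h₁ := ih (by omega)
        have h₂ := hgeo i (i + 1) i.le_succ hi
        have h₃ := hX.dist_triangle (u := f (q i)) (v := p.getVert i) (w := f (q (i + 1)))
        have h₄ := hX.dist_triangle (u := p.getVert i) (v := p.getVert (i + 1))
          (w := f (q (i + 1)))
        have h₅ := hq i
        rw [X.dist_comm] at h₅
        have h₆ := hq (i + 1)
        have h₇ := hC (q i) (q (i + 1)) (by omega)
        have h₈ := hY.dist_triangle (u := y) (v := q i) (w := q (i + 1))
        rw [mul_add_one]
        omega
    have h₁ := hind _ le_rfl
    have h₂ := hq p.length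
    rw [p.getVert_length, X.dist_comm] at h₂
    have h₃ := hC (q p.length) z (by omega)
    have h₄ := hY.dist_triangle (u := y) (v := q p.length) (w := z)
    rw [hp] at h₁ h₃ h₄
    omega
  refine ⟨2 * C + 1, fun y z => ?_, fun y z => ?_⟩
  · have h₁ : (X.dist (f y) (f z) : ℝ) ≤ Y.dist y z := by exact_mod_cast hf y z
    have h₂ : (0 : ℝ) ≤ C * Y.dist y z := by positivity
    have h₃ : (0 : ℝ) ≤ C := by positivity
    linarith
  · have h₁ : (Y.dist y z : ℝ) ≤ C * X.dist (f y) (f z) + 2 * C := by exact_mod_cast key y z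
    have h₂ : (0 : ℝ) ≤ C * X.dist (f y) (f z) := by positivity
    have h₃ : (0 : ℝ) ≤ X.dist (f y) (f z) := by positivity
    linarith

/-- A Lipschitz quasi-isometric embedding of hyperbolic graphs does not increase Gromov products
by more than a constant. -/
lemma IsQIEmbedding.exists_gromovProduct_le_add {L δ δ' : ℝ} (hf : IsQIEmbedding Y X L f)
    (h : IsHyperbolicWith X δ) (hX : X.Connected) (h' : IsHyperbolicWith Y δ') (hY : Y.Connected)
    (hlip : ∀ y z, X.dist (f y) (f z) ≤ Y.dist y z) :
    ∃ K : ℝ, ∀ w y z, gromovProduct X (f w) (f y) (f z) ≤ gromovProduct Y w y z + K := by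
  obtain ⟨K, -, hK⟩ := hf.exists_gromovProduct_le hY hX h
  -- Some `c i` on a geodesic from `y` to `z` is within `(y | z)_w + 2 * δ' + 1` of `w`, and its
  -- image has product at most `K` with the images of the ends. Moving the base point from `f w` to
  -- `f (c i)` costs at most their distance.
  refine ⟨2 * δ' + 1 + K, fun w y z => ?_⟩
  obtain ⟨c, h₀, hm, hc⟩ := exists_isGeodesic hY y z
  obtain ⟨i, hi, hi'⟩ := h'.exists_dist_geodesic_le hY hc w
  have h₁ := hK c _ hc i hi
  rw [h₀, hm] at hi' h₁
  have h₂ := gromovProduct_le_base_add_dist hX (f w) (f (c i)) (f y) (f z)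
  have h₃ : (X.dist (f w) (f (c i)) : ℝ) ≤ Y.dist w (c i) := by exact_mod_cast hlip _ _
  linarith

end Embedding

lemma gromovProduct_smul {V : Type u} {X : SimpleGraph V} {G : Type v} [Group G] [MulAction G V]
    (h : ∀ (g : G) (x y : V), X.Adj (g • x) (g • y) ↔ X.Adj x y) (hX : X.Connected)
    (g : G) (w x y : V) :
    gromovProduct X (g • w) (g • x) (g • y) = gromovProduct X w x y := by
  simp only [gromovProduct, SimpleGraph.dist_smul h hX]

end GraphGeometry

open GraphGeometry TDLC in
theorem proposition3p10
    {G : Type*} [Group G] [TopologicalSpace G] [IsTopologicalGroup G] [T2Space G]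
    [SecondCountableTopology G] [LocallyCompactSpace G] [TotallyDisconnectedSpace G]
    (hG : TDLC.IsHyperbolicGroup G)
    (H : Subgroup G) (hHopen : IsOpen (H : Set G)) (hH : TDLC.IsHyperbolicGroup H)
    -- Cayley-Abels graphs `Γ_G` of `G` and `Γ_H ⊆ Γ_G` of `H`
    (U : Subgroup G) (A_G : Set G) (A_H : Set H)
    (hΓG : TDLC.IsCayleyAbelsData U A_G)
    (hΓH : TDLC.IsCayleyAbelsData (U.subgroupOf H) A_H)
    (hA : ∀ a ∈ A_H, (a : G) ∈ A_G)
    -- the Cannon-Thurston map of the pair `(H, G)`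
    (ct : TDLC.Boundary (U.subgroupOf H) A_H → TDLC.Boundary U A_G)
    (hct : GraphGeometry.IsCannonThurstonMap (TDLC.cosetMap H U) ct)
    -- any Cayley-Abels graph `X` of `G`, with respect to which quasiconvexity is tested
    {V : Type*} [MulAction G V] (X : SimpleGraph V) (hX : TDLC.IsCayleyAbelsGraph G X) :
    Function.Injective ct ↔ TDLC.IsQuasiconvexSubgroup H X := by
  have hcaG := hΓG.isCayleyAbelsGraph
  have hcaH := hΓH.isCayleyAbelsGraph
  obtain ⟨δ, hδ⟩ := hcaG.isGromovHyperbolic hG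
  obtain ⟨δ', hδ'⟩ := hcaH.isGromovHyperbolic hH
  replace hδ : IsHyperbolicWith (cosetGraph U A_G) δ := hδ
  replace hδ' : IsHyperbolicWith (cosetGraph (U.subgroupOf H) A_H) δ' := hδ'
  have hlip := dist_cosetMap_le hΓG hΓH hA
  constructor
  · intro hinj
    obtain ⟨M, hM⟩ := hct.exists_gromovProduct_lt hinj hδ hcaG.connected hδ' hcaH.connected
      hcaH.locallyFinite rfl hlip 1
    obtain ⟨x⟩ := hX.connected.nonempty
    refine ⟨x, hX.isQuasiconvex_orbit hcaG hG H x ((1 : G) : G ⧸ U) ?_⟩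
    suffices hq : IsQuasiconvex (cosetGraph U A_G) (Set.range (cosetMap H U)) by
      rw [range_cosetMap] at hq
      exact hq
    refine isQuasiconvex_range (M := M) hδ hcaG.connected hcaH.connected hlip
      fun p y z hp => ?_
    -- The bound `hM` is known only at the trivial coset; equivariance under `H` carries it to `p`
    -- with the same `M`.
    obtain ⟨h, rfl⟩ := hcaH.exists_smul_eq ((1 : H) : H ⧸ U.subgroupOf H) p
    have h₁ := hM (h⁻¹ • y) (h⁻¹ • z)
    rw [← gromovProduct_smul hcaH.adj_smul_iff hcaH.connected h, smul_inv_smul, smul_inv_smul]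
      at h₁
    have h₂ := h₁ hp
    rw [← gromovProduct_smul hcaG.adj_smul_iff hcaG.connected (h : G)] at h₂
    have h₃ : ∀ q, (h : G) • cosetMap H U q = cosetMap H U (h • q) := fun q =>
      (cosetMap_smul h q).symm
    rw [h₃, h₃, smul_inv_smul, smul_inv_smul] at h₂
    rw [cosetMap_smul]
    exact h₂
  · rintro ⟨x, hx⟩
    have hq := hcaG.isQuasiconvex_orbit hX hG H ((1 : G) : G ⧸ U) x hx
    replace hq : IsQuasiconvex (cosetGraph U A_G) (Set.range (cosetMap H U)) := by
      rw [range_cosetMap]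
      exact hq
    obtain ⟨L, hL⟩ := hq.exists_isQIEmbedding hcaG.connected hcaH.connected hlip
      (exists_dist_le_of_dist_cosetMap_le hHopen hΓG hΓH)
    obtain ⟨K, hK⟩ := hL.exists_gromovProduct_le_add hδ hcaG.connected hδ' hcaH.connected hlip
    exact hct.injective_of_gromovProduct_le hδ hcaG.connected hδ' hcaH.connected
      (hK ((1 : H) : H ⧸ U.subgroupOf H))
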